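/- Theorem. Let $0<a\le b$ and $\delta>0$. There is a constant $c>0$, depending only on $a$, $b$ and $\delta$, such that the following holds for all integers $N,n$ with $1<n\le N/2$. Consider a periodic chain of $N$ qubits (positions are taken modulo $N$) with Hamiltonian $$H=\sum_{j=1}^N H_j,$$ where each $H_j$ is a Hermitian operator acting on the two qubits at positions $j$ and $j+1$ (and as the identity on the other qubits), with $\operatorname{tr}H_j=0$ and operator norm $a\le\|H_j\|\le b$; translational invariance is not assumed. Let $|\Psi\rangle=\bigotimes_{j=1}^N|\Psi_j\rangle$, where the $|\Psi_j\rangle$ are independent and each is uniformly (Haar) distributed on the unit sphere of $\mathbb C^2$. For a set $A$ of qubits with complement $\bar A$, put $$\rho_A(t)=\operatorname{tr}_{\bar A}\left(e^{-iHt}|\Psi\rangle\langle\Psi|e^{iHt}\right),\qquad S(\rho)=-\operatorname{tr}(\rho\ln\rho),$$ and let $A_j=\{j,j+1,\dots,j+n-1\}$ (modulo $N$), $j=1,\dots,N$, be the $N$ contiguous subsystems of $n$ qubits. Then $$\Pr_\Psi\left(\text{for all } t\in\mathbb R:\ \frac1N\sum_{j=1}^N S(\rho_{A_j}(t))\le n\ln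 2-c\,\frac nN\right)\ge 1-\delta .$$ Equivalently, with probability at least $1-\delta$, the supremum over $t\in\mathbb R$ of the average entropy is at most $n\ln2-c\,n/N$. -/

import Mathlib

open MeasureTheory
open scoped Matrix

namespace QubitChain

/-- Computational basis labels of the qubits with positions in `ι`. The Hilbert space of these
qubits is the space of functions `Config ι → ℂ`. -/
abbrev Config (ι : Type*) := ι → Fin 2

/-- Operators on the qubits with positions in `ι`, as matrices in the computational basis. -/
abbrev Op (ι : Type*) := Matrix (Config ι) (Config ι) ℂ

/-- The site `j + k` of the periodic chain of `N` sites. -/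
def site {N : ℕ} (j : Fin N) (k : ℕ) : Fin N :=
  ⟨((j : ℕ) + k) % N, Nat.mod_lt _ j.pos⟩

/-- The contiguous subsystem `{j, j + 1, …, j + n - 1}` of the periodic chain. -/
def block {N : ℕ} (j : Fin N) (n : ℕ) : Finset (Fin N) :=
  (Finset.range n).image (site j)

/-- The two-qubit operator `h` acting on the qubits at positions `j` and `j + 1`, tensored with the
identity on all other qubits. -/
def bondOp {N : ℕ} (j : Fin N) (h : Matrix (Fin 2 × Fin 2) (Fin 2 × Fin 2) ℂ) : Op (Fin N) :=
  Matrix.of fun x y =>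
    if ∀ i, i ≠ j → i ≠ site j 1 → x i = y i then
      h (x j, x (site j 1)) (y j, y (site j 1))
    else 0

/-- The nearest-neighbour Hamiltonian `∑ j, H_j` on the periodic chain. -/
def hamiltonian {N : ℕ} (h : Fin N → Matrix (Fin 2 × Fin 2) (Fin 2 × Fin 2) ℂ) : Op (Fin N) :=
  ∑ j, bondOp j (h j)

/-- The operator norm of a matrix with respect to the Euclidean norm. -/
noncomputable def opNorm {κ : Type*} [Fintype κ] [DecidableEq κ] (M : Matrix κ κ ℂ) : ℝ :=
  ‖Matrix.toEuclideanCLM (𝕜 := ℂ) M‖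

/-- The reduced matrix `tr_{Aᶜ} ρ` of the qubits in `A`. -/
def reduced {ι : Type*} [Fintype ι] [DecidableEq ι] (A : Finset ι) (ρ : Op ι) :
    Op {i // i ∈ A} :=
  Matrix.of fun a b => ∑ c : Config {i // i ∉ A},
    ρ ((Equiv.piEquivPiSubtypeProd (· ∈ A) fun _ => Fin 2).symm (a, c))
      ((Equiv.piEquivPiSubtypeProd (· ∈ A) fun _ => Fin 2).symm (b, c))

/-- The von Neumann entropy `-tr (ρ ln ρ)`. The logarithm is taken in the functional calculus, and
`Real.log 0 = 0` implements the convention `0 ln 0 = 0`. -/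
noncomputable def entropy {κ : Type*} [Fintype κ] [DecidableEq κ] (ρ : Matrix κ κ ℂ) : ℝ :=
  -(ρ * cfc Real.log ρ).trace.re

/-- The rank-one operator `|Ψ⟩⟨Ψ|`. -/
def ketBra {κ : Type*} (Ψ : κ → ℂ) : Matrix κ κ ℂ :=
  Matrix.vecMulVec Ψ (star Ψ)

/-- The Schrödinger evolution `e^{-iHt} ρ e^{iHt}`. -/
noncomputable def evolve {κ : Type*} [Fintype κ] [DecidableEq κ] (H : Matrix κ κ ℂ) (t : ℝ)
    (ρ : Matrix κ κ ℂ) : Matrix κ κ ℂ :=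
  NormedSpace.exp ((-(Complex.I * t)) • H) * ρ * NormedSpace.exp ((Complex.I * t) • H)

/-- Unit vectors of `ℂ²`, the pure states of one qubit. -/
abbrev QubitState := Metric.sphere (0 : EuclideanSpace ℂ (Fin 2)) 1

/-- The uniform (Haar) probability measure on the unit vectors of `ℂ²`: the surface measure that
Lebesgue measure induces on the unit sphere, normalised to total mass one. -/
noncomputable def haarQubit : Measure QubitState :=
  ((volume : Measure (EuclideanSpace ℂ (Fin 2))).toSphere Set.univ)⁻¹ •
    (volume : Measure (EuclideanSpace ℂ (Fin 2))).toSphere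

instance : IsProbabilityMeasure haarQubit := by
  have h0 : (volume : Measure (EuclideanSpace ℂ (Fin 2))).toSphere ≠ 0 := Measure.toSphere_ne_zero _
  refine ⟨?_⟩
  rw [haarQubit, Measure.smul_apply, smul_eq_mul]
  exact ENNReal.inv_mul_cancel (Measure.measure_univ_ne_zero.2 h0) (measure_ne_top _ _)

/-- The law of `N` independent Haar-random qubit states. -/
noncomputable def haarProduct (N : ℕ) : Measure (Fin N → QubitState) :=
  Measure.pi fun _ => haarQubit

instance (N : ℕ) : IsProbabilityMeasure (haarProduct N) := by
  unfold haarProduct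
  infer_instance

/-- The product state `⨂ j, |ψ j⟩`. -/
noncomputable def productState {N : ℕ} (ψ : Fin N → QubitState) : Config (Fin N) → ℂ :=
  fun x => ∏ j, (ψ j : EuclideanSpace ℂ (Fin 2)) (x j)

/-- The entanglement entropy `S(ρ_A(t))`, where `ρ_A(t)` is the reduced density matrix of
`e^{-iHt}|Ψ⟩⟨Ψ|e^{iHt}` on `A`. -/
noncomputable def entanglementEntropy {ι : Type*} [Fintype ι] [DecidableEq ι] (H : Op ι)
    (Ψ : Config ι → ℂ) (t : ℝ) (A : Finset ι) : ℝ :=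
  entropy (reduced A (evolve H t (ketBra Ψ)))

/-- The average of the entanglement entropy at time `t` over the `N` contiguous subsystems of
size `n` of the periodic chain. -/
noncomputable def averageEntropy {N : ℕ} (H : Op (Fin N)) (Ψ : Config (Fin N) → ℂ) (t : ℝ)
    (n : ℕ) : ℝ :=
  (∑ j : Fin N, entanglementEntropy H Ψ t (block j n)) / N

end QubitChain

namespace QubitChain

/-! Energy is conserved, and a random product state typically has non-negligible energy; this energy
must be carried by two-qubit correlations at all times, which keep the reduced states away from the
maximally mixed one.

Write `H` as a real combination of Pauli strings on single sites and nearest-neighbour bonds, with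
`W` the sum of squared coefficients (`exists_hamiltonian_eq_pauliSum`). By Cauchy–Schwarz, the
squared energy is at most `W` times the sum of the squared expectation values of the strings. So if
the squared energy is at least `ε * W`, that sum is at least `ε` at every time, whatever the scale
of `H`.

Entropy (`entropy_le_of_strings`): after fixing the types of the two Pauli factors, the strings on
disjoint bonds of a block commute and can be measured jointly. Klein's inequality, with a
product-form trial distribution tilted by the expectation values, gives an entropy deficit of at
least 1/8 of the sum of their squares. Summing over all blocks counts each bond `n / 2` times, hence
a mean deficit of order `n / N`.

Anticoncentration (`exists_smallBall_chain`): the energy is a quadratic function of independent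
Bloch vectors. Colour the cycle with three colours. Given the other qubits, the energy is affine in
the Bloch vectors of one colour class. For affine functions, each Bloch vector contributes a sinc
factor to the characteristic function, and averaging over a Gaussian frequency gives a small-ball
bound (`exists_smallBall_linear`). The random coefficients of the affine function are themselves
affine in two Bloch vectors, so the same bound shows that they are rarely small. -/

/-! ### The law of a squared amplitude of a Haar-random qubit -/

open Set Real in
/-- Two-dimensional Lebesgue measure of a solid cone in `ℂ × ℂ`. -/
theorem volume_complex_cone (p : ℝ) (hp : 0 < p) (hp1 : p ≤ 1) :
    (volume : Measure (ℂ × ℂ)) {x | ‖x.1‖ ^ 2 + ‖x.2‖ ^ 2 < 1 ∧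
      ‖x.1‖ ^ 2 ≤ p * (‖x.1‖ ^ 2 + ‖x.2‖ ^ 2)} = ENNReal.ofReal (p * (π ^ 2 / 2)) := by
  have hms : MeasurableSet {x : ℂ × ℂ | ‖x.1‖ ^ 2 + ‖x.2‖ ^ 2 < 1 ∧
      ‖x.1‖ ^ 2 ≤ p * (‖x.1‖ ^ 2 + ‖x.2‖ ^ 2)} := by
    have h1 : Measurable fun x : ℂ × ℂ => ‖x.1‖ ^ 2 + ‖x.2‖ ^ 2 := by fun_prop
    have h2 : Measurable fun x : ℂ × ℂ => ‖x.1‖ ^ 2 := by fun_prop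
    exact (measurableSet_lt h1 measurable_const).inter (measurableSet_le h2 (h1.const_mul p))
  rw [Measure.volume_eq_prod, Measure.prod_apply hms]
  have key : ∀ x : ℂ, volume (Prod.mk x ⁻¹' {x : ℂ × ℂ | ‖x.1‖ ^ 2 + ‖x.2‖ ^ 2 < 1 ∧
      ‖x.1‖ ^ 2 ≤ p * (‖x.1‖ ^ 2 + ‖x.2‖ ^ 2)}) =
        ENNReal.ofReal (max 0 (π * (1 - ‖x‖ ^ 2 / p))) := by
    intro x
    set u := ‖x‖ ^ 2 with hu
    have hu0 : 0 ≤ u := by positivity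
    -- The slice over `x` is an annulus, empty unless `u < p`; its squared radii differ by `1 - u /
    -- p`.
    have h1 : Prod.mk x ⁻¹' {x : ℂ × ℂ | ‖x.1‖ ^ 2 + ‖x.2‖ ^ 2 < 1 ∧
      ‖x.1‖ ^ 2 ≤ p * (‖x.1‖ ^ 2 + ‖x.2‖ ^ 2)} =
        Metric.ball 0 (√(1 - u)) \ Metric.ball 0 (√((1 - p) / p * u)) := by
      ext y
      have hq : 0 ≤ (1 - p) / p * u := by
        have : 0 ≤ 1 - p := by linarith
        positivity
      simp only [mem_preimage, mem_ofPred_eq, mem_sdiff, Metric.mem_ball, dist_zero_right, not_lt,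
        Real.lt_sqrt (norm_nonneg y), ← hu]
      refine and_congr ⟨fun h => by linarith, fun h => by linarith⟩ ?_
      rw [div_mul_eq_mul_div, div_le_iff₀ hp]
      constructor <;> intro h <;> nlinarith
    rw [h1]
    by_cases hup : u < p
    · have hle : (1 - p) / p * u ≤ 1 - u := by
        rw [div_mul_eq_mul_div, div_le_iff₀ hp]; nlinarith
      have hq : 0 ≤ (1 - p) / p * u := by
        have : 0 ≤ 1 - p := by linarith
        positivity
      rw [measure_sdiff (Metric.ball_subset_ball (Real.sqrt_le_sqrt hle))
        Metric.isOpen_ball.measurableSet.nullMeasurableSet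
        (measure_ball_lt_top.ne), Complex.volume_ball, Complex.volume_ball,
        ← ENNReal.ofReal_pow (Real.sqrt_nonneg _), ← ENNReal.ofReal_pow (Real.sqrt_nonneg _),
        Real.sq_sqrt (hq.trans hle), Real.sq_sqrt hq, ← ENNReal.ofReal_coe_nnreal,
        NNReal.coe_real_pi, ← ENNReal.ofReal_mul (hq.trans hle), ← ENNReal.ofReal_mul hq,
        ← ENNReal.ofReal_sub _ (by positivity), max_eq_right]
      · congr 1; field_simp; ring
      · have : u / p ≤ 1 := by rw [div_le_one hp]; exact hup.le
        have := Real.pi_pos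
        apply mul_nonneg this.le; linarith
    · have hle : 1 - u ≤ (1 - p) / p * u := by
        rw [div_mul_eq_mul_div, le_div_iff₀ hp]; nlinarith
      rw [sdiff_eq_empty.2 (Metric.ball_subset_ball (Real.sqrt_le_sqrt hle)), measure_empty,
        max_eq_left, ENNReal.ofReal_zero]
      have : 1 ≤ u / p := by rw [one_le_div hp]; linarith
      exact mul_nonpos_of_nonneg_of_nonpos Real.pi_pos.le (by linarith)
  simp_rw [key]
  set f : ℝ → ℝ := fun r => max 0 (π * (1 - r ^ 2 / p)) with hf
  have hfc : Continuous f := by fun_prop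
  have hsupp : ∀ r, √p < r → f r = 0 := by
    intro r hr
    have : p < r ^ 2 := (Real.sqrt_lt' ((Real.sqrt_nonneg p).trans_lt hr)).1 hr
    have : 1 ≤ r ^ 2 / p := by rw [one_le_div hp]; linarith
    exact max_eq_left (mul_nonpos_of_nonneg_of_nonpos Real.pi_pos.le (by linarith))
  have hint : Integrable (fun x : ℂ => f ‖x‖) := by
    apply Continuous.integrable_of_hasCompactSupport (by fun_prop)
    apply HasCompactSupport.intro (isCompact_closedBall (0 : ℂ) (√p))
    intro x hx
    apply hsupp
    simpa using hx
  change ∫⁻ x : ℂ, ENNReal.ofReal (f ‖x‖) = _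
  rw [← ofReal_integral_eq_lintegral_ofReal hint (ae_of_all _ fun x => le_max_left _ _),
    integral_fun_norm_addHaar]
  congr 1
  have hb : (volume : Measure ℂ).real (Metric.ball 0 1) = π := by
    simp [measureReal_def, Complex.volume_ball]
  rw [hb, Complex.finrank_real_complex]
  have h2 : ∫ y in Ioi (0 : ℝ), y ^ (2 - 1) • f y = ∫ y in (0 : ℝ)..√p, y * (π * (1 - y ^ 2 / p)) := by
    rw [intervalIntegral.integral_of_le (Real.sqrt_nonneg p)]
    rw [setIntegral_eq_of_subset_of_forall_sdiff_eq_zero (s := Ioc 0 (√p)) measurableSet_Ioi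
      Ioc_subset_Ioi_self]
    · apply setIntegral_congr_fun measurableSet_Ioc
      intro y hy
      simp only [pow_one, smul_eq_mul, hf, Nat.add_one_sub_one]
      rw [max_eq_right]
      have h3 : y ^ 2 ≤ p := (Real.le_sqrt' hy.1).1 hy.2
      have : y ^ 2 / p ≤ 1 := by rw [div_le_one hp]; exact h3
      exact mul_nonneg Real.pi_pos.le (by linarith)
    · intro y hy
      have : √p < y := by
        by_contra hcon
        exact hy.2 ⟨hy.1, not_lt.1 hcon⟩
      rw [hsupp y this, smul_zero]
  rw [h2]
  have h3 : ∫ y in (0 : ℝ)..√p, y * (π * (1 - y ^ 2 / p)) =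
      (π * ((√p) ^ 2 / 2 - (√p) ^ 4 / 4 / p)) - (π * ((0:ℝ) ^ 2 / 2 - (0 : ℝ) ^ 4 / 4 / p)) := by
    apply intervalIntegral.integral_eq_sub_of_hasDerivAt (f := fun y => π * (y ^ 2 / 2 - y ^ 4 / 4 / p))
    · intro y _
      have := (((hasDerivAt_pow 2 y).div_const 2).sub
        (((hasDerivAt_pow 4 y).div_const 4).div_const p)).const_mul π
      refine HasDerivAt.congr_deriv this ?_
      push_cast
      ring
    · apply Continuous.intervalIntegrable; fun_prop
  rw [h3]
  have h4 : (√p) ^ 4 = p ^ 2 := by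
    rw [show (√p) ^ 4 = ((√p) ^ 2) ^ 2 by ring, Real.sq_sqrt hp.le]
  rw [h4, Real.sq_sqrt hp.le]
  simp only [nsmul_eq_mul, smul_eq_mul]
  push_cast; field_simp; ring


/-- The coordinates of a vector of `ℂ²`, as a pair. -/
noncomputable def coordPair : EuclideanSpace ℂ (Fin 2) ≃L[ℝ] ℂ × ℂ :=
  (PiLp.continuousLinearEquiv 2 ℝ fun _ : Fin 2 => ℂ).trans
    (ContinuousLinearEquiv.finTwoArrow ℝ ℂ)

theorem coordPair_apply (x : EuclideanSpace ℂ (Fin 2)) : coordPair x = (x 0, x 1) := rfl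

-- Archimedes' hat-box theorem for the Bloch sphere: the surface measure of a set is the real
-- dimension times the volume of the cone over it, and the volume of the relevant cone is linear in
-- `p`.
open Set Real Pointwise in
theorem haarQubit_normSq_zero_le (p : ℝ) (hp : 0 < p) (hp1 : p ≤ 1) :
    haarQubit {ψ : QubitState | ‖(ψ : EuclideanSpace ℂ (Fin 2)) 0‖ ^ 2 ≤ p} = ENNReal.ofReal p := by
  set E := EuclideanSpace ℂ (Fin 2)
  set ν : Measure E := ((volume : Measure ℂ).prod (volume : Measure ℂ)).map coordPair.symm with hν
  have hνH : ν.IsAddHaarMeasure := ContinuousLinearEquiv.isAddHaarMeasure_map _ _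
  -- The factor between the Euclidean volume and the product volume need not be computed: it cancels
  -- in the normalisation of `haarQubit`.
  set c := Measure.addHaarScalarFactor (volume : Measure E) ν
  have hc : (volume : Measure E) = c • ν := Measure.isAddLeftInvariant_eq_smul _ _
  have hc0 : c ≠ 0 := by
    intro h0
    rw [h0, zero_smul] at hc
    exact (IsOpen.measure_pos volume (isOpen_univ : IsOpen (univ : Set E)) ⟨0, trivial⟩).ne'
      (by rw [hc]; simp)
  have hcone : ∀ q : ℝ, 0 < q → q ≤ 1 → (volume : Measure E).toSphere
      {ψ : QubitState | ‖(ψ : E) 0‖ ^ 2 ≤ q} =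
      (Module.finrank ℝ E : ENNReal) * (c * (ENNReal.ofReal q * ENNReal.ofReal (π ^ 2 / 2))) := by
    intro q hq hq1
    have hm : MeasurableSet {ψ : QubitState | ‖(ψ : E) 0‖ ^ 2 ≤ q} := by
      apply IsClosed.measurableSet
      apply isClosed_le _ continuous_const
      fun_prop
    rw [Measure.toSphere_apply' _ hm]
    have hset : Ioo (0 : ℝ) 1 • (Subtype.val '' {ψ : QubitState | ‖(ψ : E) 0‖ ^ 2 ≤ q}) =
        coordPair ⁻¹' {x | ‖x.1‖ ^ 2 + ‖x.2‖ ^ 2 < 1 ∧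
          ‖x.1‖ ^ 2 ≤ q * (‖x.1‖ ^ 2 + ‖x.2‖ ^ 2)} \ {0} := by
      have hn : ∀ x : E, ‖x 0‖ ^ 2 + ‖x 1‖ ^ 2 = ‖x‖ ^ 2 := by
        intro x; rw [EuclideanSpace.norm_sq_eq, Fin.sum_univ_two]
      ext x
      simp only [mem_sdiff, mem_preimage, coordPair_apply, mem_ofPred_eq, hn, mem_singleton_iff]
      constructor
      · rintro ⟨r, hr, _, ⟨ψ, hψ, rfl⟩, rfl⟩
        have h1 : ‖(ψ : E)‖ = 1 := by simp
        have h2 : ‖r • (ψ : E)‖ = r := by rw [norm_smul, h1, mul_one, Real.norm_of_nonneg hr.1.le]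
        simp only [mem_ofPred_eq] at hψ
        refine ⟨⟨?_, ?_⟩, ?_⟩
        · simp only [h2]; nlinarith [hr.1, hr.2]
        · simp only [h2, PiLp.smul_apply, norm_smul, Real.norm_of_nonneg hr.1.le]
          nlinarith [sq_nonneg r]
        · intro h0
          simp only at h0
          rw [h0, norm_zero] at h2
          exact hr.1.ne h2
      · rintro ⟨⟨h1, h2⟩, h3⟩
        have hx : 0 < ‖x‖ := norm_pos_iff.2 h3
        refine ⟨‖x‖, ⟨hx, by nlinarith⟩, ‖x‖⁻¹ • x, ⟨⟨‖x‖⁻¹ • x, ?_⟩, ?_, rfl⟩, ?_⟩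
        · simp [norm_smul, hx.ne']
        · simp only [mem_ofPred_eq, PiLp.smul_apply, norm_smul, norm_inv, norm_norm, mul_pow]
          rw [inv_pow, inv_mul_le_iff₀ (by positivity)]
          linarith
        · simp [smul_smul, hx.ne']
    rw [hset, measure_sdiff_null (measure_singleton _), hc, Measure.smul_apply, hν,
      ← ContinuousLinearEquiv.coe_toHomeomorph, ← Homeomorph.toMeasurableEquiv_coe,
      MeasurableEquiv.map_apply]
    have hpre : (coordPair.symm.toHomeomorph.toMeasurableEquiv) ⁻¹' (coordPair ⁻¹'
        {x | ‖x.1‖ ^ 2 + ‖x.2‖ ^ 2 < 1 ∧ ‖x.1‖ ^ 2 ≤ q * (‖x.1‖ ^ 2 + ‖x.2‖ ^ 2)}) =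
        {x | ‖x.1‖ ^ 2 + ‖x.2‖ ^ 2 < 1 ∧ ‖x.1‖ ^ 2 ≤ q * (‖x.1‖ ^ 2 + ‖x.2‖ ^ 2)} := by
      ext x
      simp
    rw [hpre, ← Measure.volume_eq_prod, volume_complex_cone q hq hq1, ENNReal.ofReal_mul hq.le]
    rfl
  have huniv : (univ : Set QubitState) = {ψ : QubitState | ‖(ψ : E) 0‖ ^ 2 ≤ 1} := by
    ext ψ
    have h1 : ‖(ψ : E)‖ = 1 := by simp
    have := EuclideanSpace.norm_sq_eq (ψ : E)
    rw [Fin.sum_univ_two, h1] at this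
    simp only [mem_univ, mem_ofPred_eq, true_iff]
    nlinarith [sq_nonneg ‖(ψ : E) 1‖]
  rw [haarQubit, Measure.smul_apply, smul_eq_mul, huniv, hcone p hp hp1, hcone 1 one_pos le_rfl]
  have hpi : 0 < π ^ 2 / 2 := by positivity
  set d : ENNReal := (Module.finrank ℝ E : ENNReal) * (c * ENNReal.ofReal (π ^ 2 / 2)) with hd
  have hd0 : d ≠ 0 := by
    have h1 : Module.finrank ℝ E ≠ 0 := Module.finrank_pos.ne'
    have h2 : ENNReal.ofReal (π ^ 2 / 2) ≠ 0 := by simpa using hpi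
    simp only [hd, ne_eq, mul_eq_zero, not_or]
    exact ⟨by exact_mod_cast h1, by exact_mod_cast hc0, h2⟩
  have hdt : d ≠ ⊤ := by finiteness
  rw [show (Module.finrank ℝ E : ENNReal) * (c * (ENNReal.ofReal 1 * ENNReal.ofReal (π ^ 2 / 2)))
    = d by rw [ENNReal.ofReal_one, one_mul],
    show (Module.finrank ℝ E : ENNReal) * (c * (ENNReal.ofReal p * ENNReal.ofReal (π ^ 2 / 2)))
      = d * ENNReal.ofReal p by rw [hd]; ring, ← mul_assoc, ENNReal.inv_mul_cancel hd0 hdt, one_mul]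

open Set Real in
theorem haarQubit_map_normSq_zero :
    haarQubit.map (fun ψ : QubitState => ‖(ψ : EuclideanSpace ℂ (Fin 2)) 0‖ ^ 2) =
      volume.restrict (Ioc (0 : ℝ) 1) := by
  have hmeas : Measurable fun ψ : QubitState => ‖(ψ : EuclideanSpace ℂ (Fin 2)) 0‖ ^ 2 :=
    Continuous.measurable (by fun_prop)
  have : IsProbabilityMeasure
      (haarQubit.map (fun ψ : QubitState => ‖(ψ : EuclideanSpace ℂ (Fin 2)) 0‖ ^ 2)) :=
    Measure.isProbabilityMeasure_map hmeas.aemeasurable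
  apply Measure.ext_of_Iic
  intro p
  rw [Measure.map_apply hmeas measurableSet_Iic, Measure.restrict_apply measurableSet_Iic]
  have hset : Iic p ∩ Ioc (0 : ℝ) 1 = Ioc 0 (min p 1) := by
    ext x; simp only [mem_inter_iff, mem_Iic, mem_Ioc, le_min_iff]; tauto
  rw [hset, Real.volume_Ioc, sub_zero]
  rcases le_or_gt p 0 with hp | hp
  · rw [min_eq_left (hp.trans zero_le_one), ENNReal.ofReal_of_nonpos hp]
    apply le_antisymm _ zero_le
    apply ENNReal.le_of_forall_pos_le_add
    intro ε hε _
    have h1 : 0 < min (ε : ℝ) 1 := lt_min (by exact_mod_cast hε) one_pos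
    calc haarQubit ((fun ψ : QubitState => ‖(ψ : EuclideanSpace ℂ (Fin 2)) 0‖ ^ 2) ⁻¹' Iic p)
        ≤ haarQubit {ψ : QubitState | ‖(ψ : EuclideanSpace ℂ (Fin 2)) 0‖ ^ 2 ≤ min (ε : ℝ) 1} :=
          measure_mono fun ψ hψ => le_trans (le_trans hψ hp) h1.le
      _ = ENNReal.ofReal (min (ε : ℝ) 1) := haarQubit_normSq_zero_le _ h1 (min_le_right _ _)
      _ ≤ ENNReal.ofReal ε := ENNReal.ofReal_le_ofReal (min_le_left _ _)
      _ = 0 + ε := by simp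
  · rcases le_or_gt p 1 with hp1 | hp1
    · rw [min_eq_left hp1]
      exact haarQubit_normSq_zero_le p hp hp1
    · rw [min_eq_right hp1.le, ← haarQubit_normSq_zero_le 1 one_pos le_rfl]
      apply le_antisymm
      · rw [haarQubit_normSq_zero_le 1 one_pos le_rfl, ENNReal.ofReal_one]
        exact prob_le_one
      · exact measure_mono fun ψ hψ => le_trans hψ hp1.le

/-! ### Bloch vectors and their characteristic function -/

/-- The Pauli matrices. -/
def pauli : Fin 3 → Matrix (Fin 2) (Fin 2) ℂ :=
  ![!![0, 1; 1, 0], !![0, -Complex.I; Complex.I, 0], !![1, 0; 0, -1]]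

theorem pauli_isHermitian (α : Fin 3) : (pauli α).IsHermitian := by
  fin_cases α <;> ext i j <;> fin_cases i <;> fin_cases j <;> simp [pauli]

theorem pauli_mul_self (α : Fin 3) : pauli α * pauli α = 1 := by
  fin_cases α <;> ext i j <;> fin_cases i <;> fin_cases j <;> simp [pauli]

theorem pauli_trace (α : Fin 3) : (pauli α).trace = 0 := by
  fin_cases α <;> simp [pauli, Matrix.trace_fin_two]

/-- The expectation value of `σ` in the state `ψ` of one qubit. -/
noncomputable def expect (σ : Matrix (Fin 2) (Fin 2) ℂ) (ψ : QubitState) : ℝ :=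
  (star (ψ : EuclideanSpace ℂ (Fin 2)).ofLp ⬝ᵥ (σ *ᵥ (ψ : EuclideanSpace ℂ (Fin 2)).ofLp)).re

@[fun_prop]
theorem continuous_expect (σ : Matrix (Fin 2) (Fin 2) ℂ) : Continuous (expect σ) := by
  unfold expect
  simp only [dotProduct, Matrix.mulVec]
  fun_prop

theorem expect_sum_smul {κ : Type*} (s : Finset κ) (a : κ → ℝ)
    (σ : κ → Matrix (Fin 2) (Fin 2) ℂ) (ψ : QubitState) :
    expect (∑ k ∈ s, (a k : ℂ) • σ k) ψ = ∑ k ∈ s, a k * expect (σ k) ψ := by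
  simp only [expect, Matrix.sum_mulVec, dotProduct_sum, Complex.re_sum, Matrix.smul_mulVec,
    dotProduct_smul, smul_eq_mul, Complex.re_ofReal_mul]

/-- A linear isometry of `ℂ²` acting on unit vectors. -/
noncomputable def sphereMap
    (f : EuclideanSpace ℂ (Fin 2) ≃ₗᵢ[ℂ] EuclideanSpace ℂ (Fin 2)) (ψ : QubitState) : QubitState :=
  ⟨f ψ, by simp⟩

-- A unitary preserves Lebesgue measure and maps the cone over a set to the cone over its image.
open Set Pointwise in
theorem measurePreserving_sphereMap
    (f : EuclideanSpace ℂ (Fin 2) ≃ₗᵢ[ℂ] EuclideanSpace ℂ (Fin 2)) :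
    MeasurePreserving (sphereMap f) haarQubit haarQubit := by
  have hm : Measurable (sphereMap f) := by
    apply Continuous.measurable
    unfold sphereMap
    exact Continuous.subtype_mk (f.continuous.comp continuous_subtype_val) _
  refine ⟨hm, ?_⟩
  ext s hs
  rw [Measure.map_apply hm hs, haarQubit, Measure.smul_apply, Measure.smul_apply,
    Measure.toSphere_apply' _ hs, Measure.toSphere_apply' _ (hm hs)]
  congr 2
  let g : EuclideanSpace ℂ (Fin 2) ≃ₗᵢ[ℝ] EuclideanSpace ℂ (Fin 2) :=
    { f.toLinearEquiv.restrictScalars ℝ with norm_map' := f.norm_map }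
  have hgf : ∀ x, g x = f x := fun _ => rfl
  rw [← g.measurePreserving.measure_preimage_emb g.toHomeomorph.measurableEmbedding
    (Ioo (0 : ℝ) 1 • (Subtype.val '' s))]
  congr 1
  ext x
  simp only [mem_preimage, mem_smul, mem_image, exists_exists_and_eq_and]
  constructor
  · rintro ⟨r, hr, ψ, hψ, rfl⟩
    exact ⟨r, hr, sphereMap f ψ, hψ, by rw [map_smul]; rfl⟩
  · rintro ⟨r, hr, φ, hφ, h⟩
    refine ⟨r, hr, sphereMap f.symm φ, ?_, ?_⟩
    · convert hφ
      apply Subtype.ext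
      simp [sphereMap]
    · apply g.injective
      rw [← h, map_smul]
      congr 1
      simp [hgf, sphereMap]

theorem normSq_add_normSq (ψ : QubitState) :
    ‖(ψ : EuclideanSpace ℂ (Fin 2)) 0‖ ^ 2 + ‖(ψ : EuclideanSpace ℂ (Fin 2)) 1‖ ^ 2 = 1 := by
  have h1 : ‖(ψ : EuclideanSpace ℂ (Fin 2))‖ = 1 := by simp
  have := EuclideanSpace.norm_sq_eq (ψ : EuclideanSpace ℂ (Fin 2))
  rw [Fin.sum_univ_two, h1] at this
  linarith

theorem expect_eq_eigenvalues {σ : Matrix (Fin 2) (Fin 2) ℂ} (hσ : σ.IsHermitian)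
    (ψ : QubitState) :
    expect σ ψ = ∑ i, hσ.eigenvalues i *
      ‖(sphereMap hσ.eigenvectorBasis.repr ψ : EuclideanSpace ℂ (Fin 2)) i‖ ^ 2 := by
  set v := (ψ : EuclideanSpace ℂ (Fin 2))
  set U : Matrix (Fin 2) (Fin 2) ℂ := hσ.eigenvectorUnitary.1
  have hv : ∀ i, (sphereMap hσ.eigenvectorBasis.repr ψ : EuclideanSpace ℂ (Fin 2)) i =
      (star U *ᵥ v.ofLp) i := by
    intro i
    simp only [sphereMap, OrthonormalBasis.repr_apply_apply, Matrix.mulVec, dotProduct,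
      Matrix.star_apply, PiLp.inner_apply, U, Matrix.IsHermitian.eigenvectorUnitary_apply]
    apply Finset.sum_congr rfl
    intro k _
    rw [RCLike.inner_apply, mul_comm]
    rfl
  have hσ' : σ = U * Matrix.diagonal (RCLike.ofReal ∘ hσ.eigenvalues) * star U := by
    conv_lhs => rw [hσ.spectral_theorem, Unitary.conjStarAlgAut_apply]
  rw [expect]
  conv_lhs => rw [hσ']
  rw [← Matrix.mulVec_mulVec, ← Matrix.mulVec_mulVec, Matrix.dotProduct_mulVec,
    show star v.ofLp ᵥ* U = star (star U *ᵥ v.ofLp) by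
      rw [Matrix.star_mulVec, Matrix.star_eq_conjTranspose, Matrix.conjTranspose_conjTranspose],
    dotProduct, Complex.re_sum]
  apply Finset.sum_congr rfl
  intro i _
  rw [hv, Matrix.mulVec_diagonal, Pi.star_apply, Function.comp_apply]
  rw [← Complex.normSq_eq_norm_sq, mul_left_comm]
  rw [show star ((star U *ᵥ v.ofLp) i) * (star U *ᵥ v.ofLp) i =
    (Complex.normSq ((star U *ᵥ v.ofLp) i) : ℂ) from (Complex.normSq_eq_conj_mul_self).symm]
  exact Complex.re_ofReal_mul _ _

/-- This bounds the squared sinc by `1 / (1 + x ^ 2 / 4)`, a form whose products over many sites are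
controlled by the sum of the `x ^ 2`. -/
theorem sin_sq_mul_le (x : ℝ) : Real.sin x ^ 2 * (1 + x ^ 2 / 4) ≤ x ^ 2 := by
  -- Since `3 < π`, the half-angle cosine is nonnegative in the first case; in the second, `sin² ≤
  -- 1` suffices.
  by_cases hx : |x| ≤ 3
  · rcases eq_or_ne x 0 with rfl | h0
    · simp
    have h3 := Real.pi_gt_three
    have hx' := abs_le.1 hx
    have h1 := Real.cos_lt_one_div_sqrt_sq_add_one (x := x / 2) (by linarith) (by linarith)
      (by simpa using h0)
    have hcos : 0 ≤ Real.cos (x / 2) :=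
      Real.cos_nonneg_of_mem_Icc ⟨by linarith, by linarith⟩
    have hpos : 0 < (x / 2) ^ 2 + 1 := by positivity
    have h2 : Real.cos (x / 2) ^ 2 * (1 + x ^ 2 / 4) ≤ 1 := by
      have h4 : Real.cos (x / 2) ^ 2 ≤ 1 / ((x / 2) ^ 2 + 1) := by
        calc Real.cos (x / 2) ^ 2 ≤ (1 / √((x / 2) ^ 2 + 1)) ^ 2 := by
              apply pow_le_pow_left₀ hcos h1.le
          _ = _ := by rw [div_pow, Real.sq_sqrt hpos.le, one_pow]
      rw [le_div_iff₀ hpos] at h4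
      linarith
    have h5 : Real.sin x = 2 * Real.sin (x / 2) * Real.cos (x / 2) := by
      rw [← Real.sin_two_mul]; congr 1; ring
    have h6 : Real.sin (x / 2) ^ 2 ≤ (x / 2) ^ 2 := sq_le_sq.2 Real.abs_sin_le_abs
    calc Real.sin x ^ 2 * (1 + x ^ 2 / 4) =
        4 * Real.sin (x / 2) ^ 2 * (Real.cos (x / 2) ^ 2 * (1 + x ^ 2 / 4)) := by rw [h5]; ring
      _ ≤ 4 * Real.sin (x / 2) ^ 2 * 1 := by gcongr
      _ ≤ x ^ 2 := by linarith
  · have h9 : 9 ≤ x ^ 2 := by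
      rw [← sq_abs]; nlinarith [not_le.1 hx]
    nlinarith [Real.sin_sq_le_one x, sq_nonneg x]

theorem norm_integral_exp_uniform_sq_le (l : ℝ) :
    ‖∫ p in (0 : ℝ)..1, Complex.exp ((l * (2 * p - 1) : ℝ) * Complex.I)‖ ^ 2 ≤
      (1 + l ^ 2 / 4)⁻¹ := by
  have hpos : 0 < 1 + l ^ 2 / 4 := by positivity
  rcases eq_or_ne l 0 with rfl | hl
  · simp
  have h1 : ∀ p : ℝ, Complex.exp ((l * (2 * p - 1) : ℝ) * Complex.I) =
      (fun t : ℝ => Complex.exp (t * Complex.I)) (2 * l * p - l) := by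
    intro p; simp only; congr 2; push_cast; ring
  simp_rw [h1]
  rw [intervalIntegral.integral_comp_mul_sub (fun t : ℝ => Complex.exp (t * Complex.I))
    (by simpa using hl : (2 * l) ≠ 0) l, show 2 * l * 0 - l = -l by ring,
    show 2 * l * 1 - l = l by ring, integral_exp_mul_I_eq_sinc, Real.sinc_of_ne_zero hl]
  have h2 : ((2 * l)⁻¹ • (2 * (l : ℂ) * ((Real.sin l / l : ℝ) : ℂ))) = ((Real.sin l / l : ℝ) : ℂ) := by
    rw [Complex.real_smul]
    have : (l : ℂ) ≠ 0 := by exact_mod_cast hl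
    push_cast
    field_simp
  rw [h2, Complex.norm_real, Real.norm_eq_abs, sq_abs, div_pow, div_le_iff₀ (by positivity),
    inv_mul_eq_div, le_div_iff₀ hpos]
  exact sin_sq_mul_le l

/-- Unitary invariance rotates the direction `a` to the third axis, where the Bloch component is
uniform on an interval; the characteristic function is then a sinc. -/
theorem norm_charFun_bloch_sq_le (a : Fin 3 → ℝ) :
    ‖∫ ψ, Complex.exp ((∑ α, a α * expect (pauli α) ψ : ℝ) * Complex.I) ∂haarQubit‖ ^ 2 ≤
      (1 + (∑ α, a α ^ 2) / 4)⁻¹ := by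
  set σ : Matrix (Fin 2) (Fin 2) ℂ := ∑ α, (a α : ℂ) • pauli α with hσdef
  have hσ : σ.IsHermitian := by
    rw [Matrix.IsHermitian, hσdef, Matrix.conjTranspose_sum]
    simp [Matrix.conjTranspose_smul, (pauli_isHermitian _).eq]
  have htr : hσ.eigenvalues 0 + hσ.eigenvalues 1 = 0 := by
    have h1 := hσ.trace_eq_sum_eigenvalues
    have h2 : σ.trace = 0 := by simp [hσdef, Matrix.trace_sum, pauli_trace]
    rw [h2, Fin.sum_univ_two] at h1
    exact Complex.ofReal_injective ((Complex.ofReal_add _ _).trans h1.symm)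
  have hdet : -(∑ α, a α ^ 2) = hσ.eigenvalues 0 * hσ.eigenvalues 1 := by
    have h1 := hσ.det_eq_prod_eigenvalues
    rw [Fin.prod_univ_two, Matrix.det_fin_two] at h1
    have h2 : σ 0 0 * σ 1 1 - σ 0 1 * σ 1 0 = ((-(∑ α, a α ^ 2) : ℝ) : ℂ) := by
      simp only [hσdef, Fin.sum_univ_three, pauli, Matrix.add_apply, Matrix.smul_apply]
      simp
      linear_combination (a 1 : ℂ) ^ 2 * Complex.I_sq
    rw [h2] at h1
    exact Complex.ofReal_injective (h1.trans (Complex.ofReal_mul _ _).symm)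
  -- Trace zero and determinant `-|a|²` make the eigenvalues `±|a|`.
  have hl : hσ.eigenvalues 0 ^ 2 = ∑ α, a α ^ 2 := by
    linear_combination hσ.eigenvalues 0 * htr + hdet
  have h3 : ∀ ψ, Complex.exp ((∑ α, a α * expect (pauli α) ψ : ℝ) * Complex.I) =
      (fun φ : QubitState => Complex.exp ((hσ.eigenvalues 0 *
        (2 * ‖(φ : EuclideanSpace ℂ (Fin 2)) 0‖ ^ 2 - 1) : ℝ) * Complex.I))
        (sphereMap hσ.eigenvectorBasis.repr ψ) := by
    intro ψ
    rw [← expect_sum_smul Finset.univ a pauli ψ, expect_eq_eigenvalues hσ, Fin.sum_univ_two]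
    have h4 := normSq_add_normSq (sphereMap hσ.eigenvectorBasis.repr ψ)
    simp only
    congr 3
    linear_combination hσ.eigenvalues 1 * h4 + (1 - ‖(sphereMap hσ.eigenvectorBasis.repr ψ :
      EuclideanSpace ℂ (Fin 2)) 0‖ ^ 2) * htr
  simp_rw [h3]
  set F : ℝ → ℂ := fun p => Complex.exp ((hσ.eigenvalues 0 * (2 * p - 1) : ℝ) * Complex.I)
  have hFc : Continuous F := by fun_prop
  have hnc : Continuous fun ψ : QubitState => ‖(ψ : EuclideanSpace ℂ (Fin 2)) 0‖ ^ 2 := by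
    fun_prop
  have h5 := measurePreserving_sphereMap hσ.eigenvectorBasis.repr
  have h6 : ∫ ψ, (fun φ : QubitState => F (‖(φ : EuclideanSpace ℂ (Fin 2)) 0‖ ^ 2))
      (sphereMap hσ.eigenvectorBasis.repr ψ) ∂haarQubit =
      ∫ φ : QubitState, F (‖(φ : EuclideanSpace ℂ (Fin 2)) 0‖ ^ 2) ∂haarQubit := by
    have h7 := integral_map (μ := haarQubit) h5.aemeasurable
      (f := fun φ : QubitState => F (‖(φ : EuclideanSpace ℂ (Fin 2)) 0‖ ^ 2))
      (hFc.comp hnc).aestronglyMeasurable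
    rw [h5.map_eq] at h7
    exact h7.symm
  rw [h6, ← integral_map (μ := haarQubit) hnc.measurable.aemeasurable
    hFc.aestronglyMeasurable, haarQubit_map_normSq_zero,
    ← intervalIntegral.integral_of_le zero_le_one, ← hl]
  exact norm_integral_exp_uniform_sq_le _

/-! ### Small-ball estimate for affine functions -/

/-- The law of independent Haar-random qubit states indexed by `ι`. -/
noncomputable abbrev haarPi (ι : Type*) [Fintype ι] : Measure (ι → QubitState) :=
  Measure.pi fun _ => haarQubit

/-- The component `α` of the Bloch vector of a qubit state. -/
noncomputable abbrev bloch (α : Fin 3) (ψ : QubitState) : ℝ := expect (pauli α) ψ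

theorem one_add_sum_le_prod_one_add {ι : Type*} (s : Finset ι) (x : ι → ℝ) (hx : ∀ i, 0 ≤ x i) :
    1 + ∑ i ∈ s, x i ≤ ∏ i ∈ s, (1 + x i) := by
  classical
  induction s using Finset.induction_on with
  | empty => simp
  | insert a s ha ih =>
    rw [Finset.sum_insert ha, Finset.prod_insert ha]
    have := Finset.sum_nonneg fun i (_ : i ∈ s) => hx i
    nlinarith [hx a, mul_nonneg (hx a) this]

/-- Independence factorises the characteristic function, the constant `c` is only a phase, and
expanding the product of the one-site denominators bounds it below by one plus their sum. The bound
depends on `a` only through its Euclidean norm. -/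
theorem norm_charFun_linear_le {ι : Type*} [Fintype ι] (c : ℝ) (a : ι → Fin 3 → ℝ) (t : ℝ) :
    ‖∫ ψ, Complex.exp ((t * (c + ∑ j, ∑ α, a j α * bloch α (ψ j)) : ℝ) * Complex.I) ∂haarPi ι‖ ≤
      √((1 + t ^ 2 * (∑ j, ∑ α, a j α ^ 2) / 4)⁻¹) := by
  have h1 : ∀ ψ : ι → QubitState,
      Complex.exp ((t * (c + ∑ j, ∑ α, a j α * bloch α (ψ j)) : ℝ) * Complex.I) =
      Complex.exp ((t * c : ℝ) * Complex.I) *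
        ∏ j, Complex.exp ((∑ α, (t * a j α) * expect (pauli α) (ψ j) : ℝ) * Complex.I) := by
    intro ψ
    rw [← Complex.exp_sum, ← Complex.exp_add, ← Finset.sum_mul, ← add_mul, ← Complex.ofReal_sum,
      ← Complex.ofReal_add, mul_add, Finset.mul_sum]
    simp_rw [Finset.mul_sum, mul_assoc]
  simp_rw [h1]
  rw [integral_const_mul, norm_mul, Complex.norm_exp_ofReal_mul_I, one_mul,
    integral_fintype_prod_eq_prod (fun j (ψ : QubitState) =>
      Complex.exp ((∑ α, (t * a j α) * expect (pauli α) ψ : ℝ) * Complex.I)), norm_prod]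
  apply Real.le_sqrt_of_sq_le
  rw [← Finset.prod_pow]
  calc _ ≤ ∏ j, (1 + (∑ α, (t * a j α) ^ 2) / 4)⁻¹ :=
        Finset.prod_le_prod (fun _ _ => by positivity) fun j _ => norm_charFun_bloch_sq_le _
    _ = (∏ j, (1 + (∑ α, (t * a j α) ^ 2) / 4))⁻¹ := Finset.prod_inv_distrib _
    _ ≤ _ := by
      apply inv_anti₀
      · have : 0 ≤ ∑ j, ∑ α, a j α ^ 2 := by positivity
        positivity
      · refine le_trans (le_of_eq ?_) (one_add_sum_le_prod_one_add Finset.univ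
          (fun j => (∑ α, (t * a j α) ^ 2) / 4) fun j => by positivity)
        simp_rw [mul_pow, ← Finset.mul_sum, ← Finset.sum_div, ← Finset.mul_sum]

open ProbabilityTheory in
theorem integral_exp_mul_I_gaussianReal (x : ℝ) :
    ∫ g, Complex.exp ((g * x : ℝ) * Complex.I) ∂gaussianReal 0 1 =
      (Real.exp (-x ^ 2 / 2) : ℂ) := by
  have h := charFun_gaussianReal (μ := 0) (v := 1) x
  rw [charFun_apply_real] at h
  simp only [NNReal.coe_one] at h
  push_cast
  rw [show (-(x : ℂ) ^ 2 / 2) = (x * (0 : ℝ) * Complex.I - (1 : ℝ) * x ^ 2 / 2 : ℂ) by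
    push_cast; ring, ← h]
  simp_rw [mul_comm (x : ℂ)]

-- Dominated convergence along `ε = 1 / (n + 1)`: the integrand tends to zero except at `g = 0`, a
-- null set for the Gaussian.
open ProbabilityTheory Filter Topology in
theorem exists_integral_gaussianReal_le (δ : ℝ) (hδ : 0 < δ) :
    ∃ ε : ℝ, 0 < ε ∧ ∫ g, √((1 + g ^ 2 / ε / 4)⁻¹) ∂gaussianReal 0 1 ≤ δ := by
  have hlim : Tendsto (fun n : ℕ => ∫ g, √((1 + g ^ 2 / (1 / ((n : ℝ) + 1)) / 4)⁻¹) ∂gaussianReal 0 1)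
      atTop (𝓝 (∫ _, (0 : ℝ) ∂gaussianReal 0 1)) := by
    apply tendsto_integral_of_dominated_convergence (fun _ => (1 : ℝ))
    · intro n
      apply Measurable.aestronglyMeasurable
      fun_prop
    · exact integrable_const _
    · intro n
      filter_upwards with g
      rw [Real.norm_of_nonneg (Real.sqrt_nonneg _)]
      apply Real.sqrt_le_one.2
      apply inv_le_one_of_one_le₀
      have : 0 ≤ g ^ 2 / (1 / ((n : ℝ) + 1)) / 4 := by positivity
      linarith
    · have h0 : ∀ᵐ g ∂gaussianReal 0 1, g ≠ 0 := by
        have := nullSingletonClass_gaussianReal (μ := 0) (v := 1) one_ne_zero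
        exact compl_mem_ae_iff.2 (measure_singleton (0 : ℝ))
      filter_upwards [h0] with g hg
      rw [← Real.sqrt_zero]
      apply (Real.continuous_sqrt.tendsto 0).comp
      apply Tendsto.inv_tendsto_atTop
      apply tendsto_atTop_add_const_left
      have : 0 < g ^ 2 / 4 := by positivity
      have h2 : Tendsto (fun n : ℕ => (g ^ 2 / 4) * ((n : ℝ) + 1)) atTop atTop :=
        (tendsto_atTop_add_const_right _ _ tendsto_natCast_atTop_atTop).const_mul_atTop this
      refine h2.congr fun n => ?_
      field_simp
  rw [integral_zero] at hlim
  obtain ⟨n, hn⟩ := (hlim.eventually (gt_mem_nhds hδ)).exists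
  exact ⟨1 / ((n : ℝ) + 1), by positivity, hn.le⟩

open ProbabilityTheory in
/-- Small-ball estimate for affine functions of independent Bloch vectors. -/
theorem exists_smallBall_linear (δ : ℝ) (hδ : 0 < δ) :
    ∃ ε : ℝ, 0 < ε ∧ ∀ {ι : Type} [Fintype ι] (c : ℝ) (a : ι → Fin 3 → ℝ),
      (haarPi ι).real {ψ | (c + ∑ j, ∑ α, a j α * bloch α (ψ j)) ^ 2 <
        ε * ∑ j, ∑ α, a j α ^ 2} ≤ δ := by
  obtain ⟨ε, hε, hK⟩ := exists_integral_gaussianReal_le (δ / 2) (by positivity)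
  refine ⟨ε, hε, fun {ι} _ c a => ?_⟩
  set A := ∑ j, ∑ α, a j α ^ 2 with hA
  have hA0 : 0 ≤ A := by positivity
  rcases hA0.eq_or_lt with h0 | hApos
  · rw [← h0]
    have : {ψ : ι → QubitState | (c + ∑ j, ∑ α, a j α * bloch α (ψ j)) ^ 2 < ε * 0} = ∅ := by
      ext ψ
      simp only [mul_zero, Set.mem_ofPred_eq, Set.mem_empty_iff_false, iff_false, not_lt]
      positivity
    rw [this]
    simpa using hδ.le
  set X : (ι → QubitState) → ℝ := fun ψ => c + ∑ j, ∑ α, a j α * bloch α (ψ j) with hX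
  have hXc : Continuous X := by fun_prop
  -- At scale `s` the Gaussian weight `f` is at least 1/2 on the small ball. Its mean is the average
  -- of the characteristic function of `X` at frequency `g / s`, with `g` standard normal, so
  -- Markov's inequality gives the bound.
  set s := √(ε * A) with hs
  have hspos : 0 < s := Real.sqrt_pos.2 (by positivity)
  have hs2 : s ^ 2 = ε * A := Real.sq_sqrt (by positivity)
  set f : (ι → QubitState) → ℝ := fun ψ => Real.exp (-(X ψ / s) ^ 2 / 2) with hf
  have hfc : Continuous f := by fun_prop
  have hfint : Integrable f (haarPi ι) := by
    apply Integrable.of_bound hfc.aestronglyMeasurable 1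
    filter_upwards with ψ
    rw [Real.norm_of_nonneg (Real.exp_nonneg _), Real.exp_le_one_iff]
    have : 0 ≤ (X ψ / s) ^ 2 := by positivity
    linarith
  have hmarkov := mul_meas_ge_le_integral_of_nonneg (μ := haarPi ι) (f := f)
    (Filter.Eventually.of_forall fun ψ => (Real.exp_nonneg _)) hfint (1 / 2)
  have hsub : {ψ | X ψ ^ 2 < ε * A} ⊆ {ψ | 1 / 2 ≤ f ψ} := by
    intro ψ hψ
    simp only [Set.mem_ofPred_eq] at hψ ⊢
    have h1 : (X ψ / s) ^ 2 ≤ 1 := by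
      rw [div_pow, hs2, div_le_one (by positivity)]; exact hψ.le
    have h2 := Real.add_one_le_exp (-(X ψ / s) ^ 2 / 2)
    simp only [hf]
    linarith
  have hgauss : ((∫ ψ, f ψ ∂haarPi ι : ℝ) : ℂ) =
      ∫ g, ∫ ψ, Complex.exp ((g / s * X ψ : ℝ) * Complex.I) ∂haarPi ι ∂gaussianReal 0 1 := by
    rw [← integral_complex_ofReal]
    rw [integral_integral_swap]
    · apply integral_congr_ae
      filter_upwards with ψ
      rw [← integral_exp_mul_I_gaussianReal]
      congr 1
      ext g
      congr 3
      ring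
    · apply Integrable.of_bound (C := 1)
      · apply Continuous.aestronglyMeasurable
        unfold Function.uncurry
        fun_prop
      · filter_upwards with z
        rw [Function.uncurry, Complex.norm_exp_ofReal_mul_I]
  have hbound : ∫ ψ, f ψ ∂haarPi ι ≤ δ / 2 := by
    calc ∫ ψ, f ψ ∂haarPi ι ≤ ‖((∫ ψ, f ψ ∂haarPi ι : ℝ) : ℂ)‖ := by
          rw [Complex.norm_real]; exact le_abs_self _
      _ ≤ ∫ g, √((1 + g ^ 2 / ε / 4)⁻¹) ∂gaussianReal 0 1 := by
        rw [hgauss]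
        apply norm_integral_le_of_norm_le
        · apply Integrable.of_bound (C := 1)
          · apply Measurable.aestronglyMeasurable
            fun_prop
          · filter_upwards with g
            rw [Real.norm_of_nonneg (Real.sqrt_nonneg _)]
            apply Real.sqrt_le_one.2
            apply inv_le_one_of_one_le₀
            have : 0 ≤ g ^ 2 / ε / 4 := by positivity
            linarith
        · filter_upwards with g
          refine (norm_charFun_linear_le c a (g / s)).trans (le_of_eq ?_)
          congr 3
          rw [div_pow, hs2, ← hA]
          field_simp
      _ ≤ δ / 2 := hK
  have := measureReal_mono (μ := haarPi ι) hsub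
  linarith

/-! ### Small-ball estimate for the energy -/

theorem bloch_sq_le_one (α : Fin 3) (ψ : QubitState) : bloch α ψ ^ 2 ≤ 1 := by
  have h := normSq_add_normSq ψ
  rw [← Complex.normSq_eq_norm_sq, ← Complex.normSq_eq_norm_sq, Complex.normSq_apply,
    Complex.normSq_apply] at h
  unfold bloch expect
  generalize (ψ : EuclideanSpace ℂ (Fin 2)).ofLp = v at *
  rw [sq_le_one_iff_abs_le_one, abs_le]
  fin_cases α <;> simp [pauli, dotProduct, Matrix.mulVec, Fin.sum_univ_two]
  · constructor <;> nlinarith [sq_nonneg ((v 0).re + (v 1).re), sq_nonneg ((v 0).im + (v 1).im),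
      sq_nonneg ((v 0).re - (v 1).re), sq_nonneg ((v 0).im - (v 1).im)]
  · constructor <;> nlinarith [sq_nonneg ((v 0).re + (v 1).im), sq_nonneg ((v 0).im + (v 1).re),
      sq_nonneg ((v 0).re - (v 1).im), sq_nonneg ((v 0).im - (v 1).re)]
  · constructor <;> nlinarith [sq_nonneg (v 0).re, sq_nonneg (v 0).im, sq_nonneg (v 1).re,
      sq_nonneg (v 1).im]

theorem two_site_sq_le (x y r s : Fin 3 → ℝ) (hr : ∀ α, r α ^ 2 ≤ 1) (hs : ∀ α, s α ^ 2 ≤ 1) :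
    (∑ α, x α * r α + ∑ α, y α * s α) ^ 2 ≤ 6 * (∑ α, x α ^ 2 + ∑ α, y α ^ 2) := by
  have h1 := Finset.sum_mul_sq_le_sq_mul_sq Finset.univ x r
  have h2 := Finset.sum_mul_sq_le_sq_mul_sq Finset.univ y s
  have h3 : ∑ α, r α ^ 2 ≤ 3 := (Finset.sum_le_sum fun α _ => hr α).trans (by simp)
  have h4 : ∑ α, s α ^ 2 ≤ 3 := (Finset.sum_le_sum fun α _ => hs α).trans (by simp)
  have h5 : (∑ α, x α ^ 2) * ∑ α, r α ^ 2 ≤ (∑ α, x α ^ 2) * 3 := by gcongr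
  have h6 : (∑ α, y α ^ 2) * ∑ α, s α ^ 2 ≤ (∑ α, y α ^ 2) * 3 := by gcongr
  nlinarith [sq_nonneg (∑ α, x α * r α - ∑ α, y α * s α)]

/-- Unlike the general affine estimate, this one also includes the constant term `c ^ 2` on the
right, which is possible because two Bloch vectors are bounded. -/
theorem exists_smallBall_two_site (δ : ℝ) (hδ : 0 < δ) :
    ∃ ε : ℝ, 0 < ε ∧ ∀ {ι : Type} [Fintype ι] (i k : ι) (_ : i ≠ k) (c : ℝ) (x y : Fin 3 → ℝ),
      (haarPi ι).real {ψ | (c + (∑ α, x α * bloch α (ψ i) + ∑ α, y α * bloch α (ψ k))) ^ 2 <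
        ε * (c ^ 2 + (∑ α, x α ^ 2 + ∑ α, y α ^ 2))} ≤ δ := by
  classical
  obtain ⟨ε, hε, hL⟩ := exists_smallBall_linear δ hδ
  refine ⟨min (1 / 5) (ε / 25), by positivity, fun {ι} _ i k hik c x y => ?_⟩
  set A := ∑ α, x α ^ 2 + ∑ α, y α ^ 2 with hA
  have hA0 : 0 ≤ A := by positivity
  -- The random part squared is at most `6 * A`. If `24 * A ≤ c ^ 2` it is at most half of `|c|` and
  -- cannot cancel the constant; otherwise `c ^ 2 + A < 25 * A` and the affine estimate applies.
  rcases le_or_gt (24 * A) (c ^ 2) with hc | hc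
  · have hempty : {ψ : ι → QubitState |
        (c + (∑ α, x α * bloch α (ψ i) + ∑ α, y α * bloch α (ψ k))) ^ 2 <
        min (1 / 5) (ε / 25) * (c ^ 2 + A)} = ∅ := by
      ext ψ
      simp only [Set.mem_ofPred_eq, Set.mem_empty_iff_false, iff_false, not_lt]
      have h1 := two_site_sq_le x y (fun α => bloch α (ψ i)) (fun α => bloch α (ψ k))
        (fun α => bloch_sq_le_one α _) (fun α => bloch_sq_le_one α _)
      rw [← hA] at h1
      set Y := ∑ α, x α * bloch α (ψ i) + ∑ α, y α * bloch α (ψ k)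
      calc min (1 / 5) (ε / 25) * (c ^ 2 + A) ≤ (1 / 5) * (c ^ 2 + A) := by
            gcongr; exact min_le_left _ _
        _ ≤ (c + Y) ^ 2 := by nlinarith [sq_nonneg (c + 2 * Y)]
    rw [hempty]
    simpa using hδ.le
  · refine le_trans (measureReal_mono ?_) (hL (ι := ι) c
      (fun j α => (if j = i then x α else 0) + (if j = k then y α else 0)))
    have hlin : ∀ ψ : ι → QubitState, ∑ j, ∑ α, ((if j = i then x α else 0) +
        (if j = k then y α else 0)) * bloch α (ψ j) =
        ∑ α, x α * bloch α (ψ i) + ∑ α, y α * bloch α (ψ k) := by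
      intro ψ
      simp_rw [add_mul, Finset.sum_add_distrib, ite_mul, zero_mul]
      congr 1 <;> rw [Finset.sum_comm] <;> simp
    have hsq : ∑ j, ∑ α, ((if j = i then x α else 0) + (if j = k then y α else 0)) ^ 2 = A := by
      have h1 : ∀ j α, ((if j = i then x α else 0) + (if j = k then y α else 0)) ^ 2 =
          (if j = i then x α ^ 2 else 0) + (if j = k then y α ^ 2 else 0) := by
        intro j α
        by_cases h1 : j = i
        · subst h1; simp [hik]
        · simp [h1]
      simp_rw [h1, Finset.sum_add_distrib]
      rw [hA]
      congr 1 <;> rw [Finset.sum_comm] <;> simp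
    intro ψ hψ
    simp only [Set.mem_ofPred_eq] at hψ ⊢
    rw [hlin, hsq]
    refine hψ.trans_le ?_
    calc min (1 / 5) (ε / 25) * (c ^ 2 + A) ≤ (ε / 25) * (c ^ 2 + A) := by
          gcongr; exact min_le_right _ _
      _ ≤ ε / 25 * (25 * A) := by gcongr; linarith
      _ = ε * A := by ring

/-- A weighted sum of nonnegative random variables is rarely small if each of them is. -/
theorem measureReal_sum_lt_le {Ω κ : Type*} [MeasurableSpace Ω] (μ : Measure Ω)
    [IsProbabilityMeasure μ] [Fintype κ] (f : κ → Ω → ℝ) (hf : ∀ k, Measurable (f k))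
    (hf0 : ∀ k ω, 0 ≤ f k ω) (w : κ → ℝ) (hw : ∀ k, 0 ≤ w k) (ε δ : ℝ) (hε : 0 < ε)
    (hδ : 0 ≤ δ) (h : ∀ k, μ.real {ω | f k ω < ε * w k} ≤ δ) :
    μ.real {ω | ∑ k, f k ω < ε / 2 * ∑ k, w k} ≤ 2 * δ := by
  classical
  set W := ∑ k, w k with hW
  have hW0 : 0 ≤ W := Finset.sum_nonneg fun k _ => hw k
  rcases hW0.eq_or_lt with h0 | hpos
  · have : {ω | ∑ k, f k ω < ε / 2 * W} = ∅ := by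
      ext ω
      simp only [← h0, mul_zero, Set.mem_ofPred_eq, Set.mem_empty_iff_false, iff_false, not_lt]
      exact Finset.sum_nonneg fun k _ => hf0 k ω
    rw [this]
    simpa using hδ
  have hms : ∀ k, MeasurableSet {ω | f k ω < ε * w k} := fun k =>
    measurableSet_lt (hf k) measurable_const
  set g : Ω → ℝ := fun ω => ∑ k, Set.indicator {ω | f k ω < ε * w k} (fun _ => w k) ω with hg
  have hint : ∀ k, Integrable (Set.indicator {ω | f k ω < ε * w k} (fun _ => w k)) μ :=
    fun k => (integrable_const _).indicator (hms k)
  have hgint : Integrable g μ := integrable_finsetSum _ fun k _ => hint k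
  have hg0 : ∀ ω, 0 ≤ g ω := fun ω =>
    Finset.sum_nonneg fun k _ => Set.indicator_nonneg (fun _ _ => hw k) _
  have hmarkov := mul_meas_ge_le_integral_of_nonneg (μ := μ) (f := g)
    (Filter.Eventually.of_forall hg0) hgint (W / 2)
  have hgi : ∫ ω, g ω ∂μ ≤ W * δ := by
    rw [hg, integral_finsetSum _ fun k _ => hint k, hW, Finset.sum_mul]
    apply Finset.sum_le_sum
    intro k _
    rw [integral_indicator (hms k), setIntegral_const, smul_eq_mul, mul_comm]
    exact mul_le_mul_of_nonneg_left (h k) (hw k)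
  -- If the sum is small, the indices with `f k < ε * w k` carry at least half of the weight, while
  -- their expected weight is at most `δ * W`.
  have hsub : {ω | ∑ k, f k ω < ε / 2 * W} ⊆ {ω | W / 2 ≤ g ω} := by
    intro ω hω
    simp only [Set.mem_ofPred_eq] at hω ⊢
    have h1 : ∀ k, ε * w k ≤ f k ω +
        ε * Set.indicator {ω | f k ω < ε * w k} (fun _ => w k) ω := by
      intro k
      by_cases hk : f k ω < ε * w k
      · rw [Set.indicator_of_mem (by exact hk)]
        linarith [hf0 k ω]
      · rw [Set.indicator_of_notMem (by exact hk)]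
        linarith
    have h2 := Finset.sum_le_sum fun k (_ : k ∈ Finset.univ) => h1 k
    rw [Finset.sum_add_distrib, ← Finset.mul_sum, ← Finset.mul_sum, ← hW] at h2
    have h3 : ε * (W / 2) ≤ ε * g ω := by simp only [hg]; linarith
    exact le_of_mul_le_mul_left h3 hε
  have h4 := measureReal_mono (μ := μ) hsub
  have h5 : W / 2 * μ.real {ω | ∑ k, f k ω < ε / 2 * W} ≤ W / 2 * (2 * δ) := by
    calc _ ≤ W / 2 * μ.real {ω | W / 2 ≤ g ω} := by gcongr
      _ ≤ W * δ := hmarkov.trans hgi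
      _ = _ := by ring
  exact le_of_mul_le_mul_left h5 (by positivity)

instance : Nonempty QubitState := by
  by_contra h
  rw [not_nonempty_iff] at h
  have h1 := measure_univ (μ := haarQubit)
  rw [Set.univ_eq_empty_iff.2 h, measure_empty] at h1
  exact zero_ne_one h1

/-- Small-ball estimate for functions that are affine in the Bloch vectors of some of the qubits,
with coefficients that depend on the other qubits. -/
theorem exists_smallBall_conditional (δ : ℝ) (hδ : 0 < δ) :
    ∃ ε : ℝ, 0 < ε ∧ ∀ {ι : Type} [Fintype ι] (p : ι → Prop) [DecidablePred p]
      (c : (ι → QubitState) → ℝ) (v : {i // p i} → Fin 3 → (ι → QubitState) → ℝ),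
      Measurable c → (∀ j α, Measurable (v j α)) →
      DependsOn c {i | ¬ p i} → (∀ j α, DependsOn (v j α) {i | ¬ p i}) →
      (haarPi ι).real {ψ | (c ψ + ∑ j, ∑ α, v j α ψ * bloch α (ψ j)) ^ 2 <
        ε * ∑ j, ∑ α, v j α ψ ^ 2} ≤ δ := by
  obtain ⟨ε, hε, hL⟩ := exists_smallBall_linear δ hδ
  refine ⟨ε, hε, fun {ι} _ p _ c v hc hv hcd hvd => ?_⟩
  set e := MeasurableEquiv.piEquivPiSubtypeProd (fun _ : ι => QubitState) p with he
  have hmp := measurePreserving_piEquivPiSubtypeProd (fun _ : ι => haarQubit) p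
  set B := {ψ : ι → QubitState | (c ψ + ∑ j : {i // p i}, ∑ α, v j α ψ * bloch α (ψ j)) ^ 2 <
        ε * ∑ j, ∑ α, v j α ψ ^ 2} with hB
  have hBm : MeasurableSet B := by
    have hb : ∀ (j : {i // p i}) α, Measurable fun ψ : ι → QubitState => bloch α (ψ j) :=
      fun j α => Continuous.measurable (by fun_prop)
    exact measurableSet_lt (by fun_prop) (by fun_prop)
  have h1 : haarPi ι B = ((haarPi {i // p i}).prod (haarPi {i // ¬ p i})) (e.symm ⁻¹' B) := by
    rw [← (hmp.symm e).measure_preimage_equiv]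
  rw [measureReal_def, h1, Measure.prod_apply_symm (e.symm.measurable hBm)]
  apply ENNReal.toReal_le_of_le_ofReal hδ.le
  calc _ ≤ ∫⁻ _ : {i // ¬ p i} → QubitState, ENNReal.ofReal δ ∂haarPi {i // ¬ p i} := by
        apply lintegral_mono
        intro b
        -- The coefficients do not see the qubits in `p`, so evaluating them at an arbitrary `a₀`
        -- freezes them on each fibre of Fubini's theorem.
        let a₀ : {i // p i} → QubitState := fun _ => Classical.arbitrary _
        have hdep : ∀ a, ∀ i ∈ {i | ¬ p i}, e.symm (a, b) i = e.symm (a₀, b) i := by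
          intro a i hi
          simp only [he, MeasurableEquiv.piEquivPiSubtypeProd, MeasurableEquiv.coe_mk,
            MeasurableEquiv.symm_mk, Equiv.piEquivPiSubtypeProd, Equiv.coe_fn_symm_mk]
          rw [dif_neg hi, dif_neg hi]
        have hin : ∀ a (j : {i // p i}), e.symm (a, b) j = a j := by
          intro a j
          simp only [he, MeasurableEquiv.piEquivPiSubtypeProd, MeasurableEquiv.coe_mk,
            MeasurableEquiv.symm_mk, Equiv.piEquivPiSubtypeProd, Equiv.coe_fn_symm_mk]
          rw [dif_pos j.2]
        have h2 := hL (c (e.symm (a₀, b))) (fun j α => v j α (e.symm (a₀, b)))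
        rw [measureReal_def, ← ENNReal.le_ofReal_iff_toReal_le (measure_ne_top _ _) hδ.le] at h2
        refine le_trans (le_of_eq (congrArg (haarPi {i // p i}) ?_)) h2
        ext a
        simp only [Set.mem_preimage, hB, Set.mem_ofPred_eq]
        rw [hcd (hdep a)]
        simp_rw [fun j α => hvd j α (hdep a), hin a]
    _ = ENNReal.ofReal δ := by simp

/-- The component `α` of the Bloch vector, where `none` stands for the identity. -/
noncomputable def blochOpt (α : Option (Fin 3)) (ψ : QubitState) : ℝ :=
  α.elim 1 fun β => bloch β ψ

/-- Small-ball estimate for the energy of a random product state. The terms couple neighbours with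
respect to the permutation `s`. -/
theorem exists_smallBall_chain (δ : ℝ) (hδ : 0 < δ) :
    ∃ ε : ℝ, 0 < ε ∧ ∀ {ι : Type} [Fintype ι] (s : Equiv.Perm ι) (col : ι → Fin 3),
      (∀ j, col (s j) ≠ col j) → (∀ j, s j ≠ s.symm j) →
      ∀ m : ι → Fin 3 → Option (Fin 3) → ℝ,
      (haarPi ι).real {ψ | (∑ j, ∑ α, ∑ β, m j α β * (bloch α (ψ j) * blochOpt β (ψ (s j)))) ^ 2 <
        ε * ∑ j, ∑ α, ∑ β, m j α β ^ 2} ≤ δ := by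
  obtain ⟨ε₁, hε₁, hcond⟩ := exists_smallBall_conditional (δ / 2) (by positivity)
  obtain ⟨ε₂, hε₂, htwo⟩ := exists_smallBall_two_site (δ / 4) (by positivity)
  refine ⟨ε₁ * (ε₂ / 6), by positivity, fun {ι} _ s col hcol hs m => ?_⟩
  -- `w j α` is the squared norm of the coefficients of `V j α`, the affine function multiplying
  -- `bloch α (ψ j)` in the energy.
  set w : ι → Fin 3 → ℝ := fun j α => m j α none ^ 2 +
    (∑ β, m j α (some β) ^ 2 + ∑ β, m (s.symm j) β (some α) ^ 2) with hw
  set W := ∑ j, ∑ α, ∑ β, m j α β ^ 2 with hW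
  have hWw : W ≤ ∑ q, ∑ j : {j // col j = q}, ∑ α, w j α := by
    have h1 : ∑ q, ∑ j : {j // col j = q}, ∑ α, w j α = ∑ j, ∑ α, w j α :=
      Fintype.sum_fiberwise col fun j => ∑ α, w j α
    rw [h1, hW]
    refine Finset.sum_le_sum fun j _ => Finset.sum_le_sum fun α _ => ?_
    rw [Fintype.sum_option]
    have : 0 ≤ ∑ β, m (s.symm j) β (some α) ^ 2 := by positivity
    simp only [hw]
    linarith
  -- Pigeonhole: one of the three colours carries at least a third of the weight.
  obtain ⟨q, hq⟩ : ∃ q, W ≤ 3 * ∑ j : {j // col j = q}, ∑ α, w j α := by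
    by_contra! hcon
    have h1 := Finset.sum_lt_sum_of_nonempty (Finset.univ_nonempty (α := Fin 3)) fun q _ => hcon q
    rw [← Finset.mul_sum] at h1
    simp only [Finset.sum_const, Finset.card_univ, Fintype.card_fin, nsmul_eq_mul] at h1
    push_cast at h1
    linarith
  set V : ι → Fin 3 → (ι → QubitState) → ℝ := fun j α ψ => m j α none +
    (∑ β, m j α (some β) * bloch β (ψ (s j)) +
      ∑ β, m (s.symm j) β (some α) * bloch β (ψ (s.symm j))) with hV
  set T : ι → (ι → QubitState) → ℝ := fun j ψ =>
    ∑ α, ∑ β, m j α (some β) * (bloch α (ψ j) * bloch β (ψ (s j))) with hT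
  set F : ι → (ι → QubitState) → ℝ := fun j ψ => ∑ α, m j α none * bloch α (ψ j) with hF
  -- The part of the energy that does not involve the qubits of colour `q`; proper colouring ensures
  -- that no bond joins two of them.
  set c : (ι → QubitState) → ℝ := fun ψ => ∑ j, if col j = q then 0 else
    F j ψ + if col (s j) = q then 0 else T j ψ with hc
  have hVm : ∀ j α, Measurable (V j α) := fun j α => Continuous.measurable (by fun_prop)
  have hTm : ∀ j, Measurable (T j) := fun j => Continuous.measurable (by fun_prop)
  have hFm : ∀ j, Measurable (F j) := fun j => Continuous.measurable (by fun_prop)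
  have hcm : Measurable c := by
    apply Finset.measurable_sum
    intro j _
    split_ifs
    · exact measurable_const
    · simpa using hFm j
    · exact (hFm j).add (hTm j)
  have hs' : ∀ j, col (s.symm j) ≠ col j := by
    intro j h
    exact hcol (s.symm j) (by rw [Equiv.apply_symm_apply, h])
  have hE : ∀ ψ, ∑ j, ∑ α, ∑ β, m j α β * (bloch α (ψ j) * blochOpt β (ψ (s j))) =
      c ψ + ∑ j : {j // col j = q}, ∑ α, V j α ψ * bloch α (ψ j) := by
    intro ψ
    have h1 : ∀ j, ∑ α, ∑ β, m j α β * (bloch α (ψ j) * blochOpt β (ψ (s j))) =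
        F j ψ + T j ψ := by
      intro j
      simp only [hF, hT, ← Finset.sum_add_distrib, Fintype.sum_option, blochOpt, Option.elim,
        mul_one]
    have h2 : ∀ j, ∑ α, V j α ψ * bloch α (ψ j) = F j ψ + T j ψ + T (s.symm j) ψ := by
      intro j
      simp only [hV, hF, hT, add_mul, Finset.sum_add_distrib, Finset.sum_mul,
        Equiv.apply_symm_apply]
      rw [add_assoc]
      congr 2
      · exact Finset.sum_congr rfl fun α _ => Finset.sum_congr rfl fun β _ => by ring
      · rw [Finset.sum_comm]
        exact Finset.sum_congr rfl fun α _ => Finset.sum_congr rfl fun β _ => by ring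
    have h3 : ∑ j : {j // col j = q}, ∑ α, V j α ψ * bloch α (ψ j) =
        ∑ j, if col j = q then F j ψ + T j ψ + T (s.symm j) ψ else 0 := by
      rw [← Finset.sum_filter, ← Finset.sum_subtype_eq_sum_filter]
      simp only [Finset.subtype_univ]
      exact Finset.sum_congr rfl fun j _ => h2 j
    have h4 : ∑ j, (if col j = q then T (s.symm j) ψ else 0) =
        ∑ j, if col (s j) = q then T j ψ else 0 := by
      rw [← Equiv.sum_comp s]
      simp
    have h5 : ∑ j, (if col j = q then F j ψ + T j ψ + T (s.symm j) ψ else 0) =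
        ∑ j, (if col j = q then F j ψ + T j ψ else 0) +
          ∑ j, if col (s j) = q then T j ψ else 0 := by
      rw [← h4, ← Finset.sum_add_distrib]
      refine Finset.sum_congr rfl fun j _ => ?_
      split_ifs <;> simp
    rw [h3, h5, hc, ← Finset.sum_add_distrib, ← Finset.sum_add_distrib]
    refine Finset.sum_congr rfl fun j _ => ?_
    rw [h1]
    have h6 := hcol j
    by_cases h7 : col j = q
    · have : col (s j) ≠ q := fun h => h6 (h.trans h7.symm)
      simp [h7, this]
    · by_cases h8 : col (s j) = q <;> simp [h7, h8]
  have hA : (haarPi ι).real {ψ | (c ψ + ∑ j : {j // col j = q}, ∑ α, V j α ψ * bloch α (ψ j)) ^ 2 <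
      ε₁ * ∑ j : {j // col j = q}, ∑ α, V j α ψ ^ 2} ≤ δ / 2 := by
    apply hcond (fun j => col j = q) c (fun j α => V j α) hcm (fun j α => hVm j α)
    · intro ψ φ h
      simp only [hc, hF, hT]
      refine Finset.sum_congr rfl fun j _ => ?_
      by_cases h7 : col j = q
      · simp [h7]
      · rw [if_neg h7, if_neg h7, h j h7]
        by_cases h8 : col (s j) = q
        · simp [h8]
        · rw [if_neg h8, if_neg h8, h (s j) h8]
    · rintro ⟨j, hj⟩ α ψ φ h
      simp only [hV]
      rw [h (s j) fun h8 => hcol j (h8.trans hj.symm),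
        h (s.symm j) fun h8 => hs' j (h8.trans hj.symm)]
  have hB : (haarPi ι).real {ψ | ∑ k : {j // col j = q} × Fin 3, V k.1 k.2 ψ ^ 2 <
      ε₂ / 2 * ∑ k : {j // col j = q} × Fin 3, w k.1 k.2} ≤ 2 * (δ / 4) := by
    apply measureReal_sum_lt_le (haarPi ι) (fun (k : {j // col j = q} × Fin 3) ψ => V k.1 k.2 ψ ^ 2)
      (fun k => (hVm _ _).pow_const 2) (fun k ψ => sq_nonneg _) _ (fun k => by positivity) ε₂ (δ / 4)
      hε₂ (by positivity)
    intro k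
    exact htwo (s k.1) (s.symm k.1) (hs _) _ _ _
  rw [Fintype.sum_prod_type] at hB
  simp_rw [Fintype.sum_prod_type] at hB
  -- A small energy means either small random coefficients or a small affine function given the
  -- coefficients. The 6 combines the 3 of the pigeonhole with the 2 lost in summing the
  -- coefficients.
  have hsub : {ψ | (∑ j, ∑ α, ∑ β, m j α β * (bloch α (ψ j) * blochOpt β (ψ (s j)))) ^ 2 <
      ε₁ * (ε₂ / 6) * W} ⊆
      {ψ | (c ψ + ∑ j : {j // col j = q}, ∑ α, V j α ψ * bloch α (ψ j)) ^ 2 <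
      ε₁ * ∑ j : {j // col j = q}, ∑ α, V j α ψ ^ 2} ∪
      {ψ | ∑ j : {j // col j = q}, ∑ α, V j α ψ ^ 2 <
      ε₂ / 2 * ∑ j : {j // col j = q}, ∑ α, w j α} := by
    intro ψ hψ
    simp only [Set.mem_ofPred_eq, Set.mem_union] at hψ ⊢
    rw [hE] at hψ
    by_contra! hcon
    have h1 : ε₁ * (ε₂ / 2 * ∑ j : {j // col j = q}, ∑ α, w j α) ≤
      ε₁ * ∑ j : {j // col j = q}, ∑ α, V j α ψ ^ 2 := by gcongr; exact hcon.2
    have h2 : ε₁ * (ε₂ / 6) * W ≤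
      ε₁ * (ε₂ / 6) * (3 * ∑ j : {j // col j = q}, ∑ α, w j α) := by gcongr
    linarith [hcon.1]
  calc _ ≤ _ := measureReal_mono hsub
    _ ≤ _ := measureReal_union_le _ _
    _ ≤ δ / 2 + 2 * (δ / 4) := add_le_add hA hB
    _ = δ := by ring

/-! ### Tensor products, entropy bounds and unitary dynamics -/

section DensityMatrices

open scoped ComplexOrder

section Tensor

variable {ι : Type*} [Fintype ι]

/-- The tensor product of one-qubit operators. -/
def tensor (f : ι → Matrix (Fin 2) (Fin 2) ℂ) : Op ι :=
  Matrix.of fun x y => ∏ i, f i (x i) (y i)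

theorem tensor_apply (f : ι → Matrix (Fin 2) (Fin 2) ℂ) (x y : Config ι) :
    tensor f x y = ∏ i, f i (x i) (y i) := rfl

theorem sum_prod_config [DecidableEq ι] {R : Type*} [CommSemiring R] (g : ι → Fin 2 → R) :
    ∑ x : Config ι, ∏ i, g i (x i) = ∏ i, ∑ b, g i b := by
  rw [Finset.prod_univ_sum, Fintype.piFinset_univ]

theorem tensor_mul [DecidableEq ι] (f g : ι → Matrix (Fin 2) (Fin 2) ℂ) :
    tensor f * tensor g = tensor fun i => f i * g i := by
  ext x y
  simp_rw [Matrix.mul_apply, tensor_apply, ← Finset.prod_mul_distrib, Matrix.mul_apply]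
  exact sum_prod_config fun i b => f i (x i) b * g i b (y i)

theorem tensor_one [DecidableEq ι] : tensor (fun _ : ι => (1 : Matrix (Fin 2) (Fin 2) ℂ)) = 1 := by
  ext x y
  rw [tensor_apply, Matrix.one_apply]
  split_ifs with h
  · exact Finset.prod_eq_one fun i _ => by rw [h]; exact Matrix.one_apply_eq _
  · obtain ⟨i, hi⟩ := Function.ne_iff.1 h
    exact Finset.prod_eq_zero (Finset.mem_univ i) (Matrix.one_apply_ne hi)

theorem tensor_conjTranspose (f : ι → Matrix (Fin 2) (Fin 2) ℂ) :
    (tensor f)ᴴ = tensor fun i => (f i)ᴴ := by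
  ext x y
  simp [Matrix.conjTranspose_apply, tensor_apply]

theorem trace_tensor [DecidableEq ι] (f : ι → Matrix (Fin 2) (Fin 2) ℂ) :
    (tensor f).trace = ∏ i, (f i).trace := by
  simp_rw [Matrix.trace, Matrix.diag_apply, tensor_apply]
  exact sum_prod_config fun i b => f i b b

theorem sum_tensor [DecidableEq ι] (f : ι → Fin 2 → Matrix (Fin 2) (Fin 2) ℂ) :
    ∑ x : Config ι, tensor (fun i => f i (x i)) = tensor fun i => ∑ b, f i b := by
  ext y z
  simp_rw [Matrix.sum_apply, tensor_apply, Matrix.sum_apply]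
  exact sum_prod_config fun i b => f i b (y i) (z i)

theorem tensor_smul (c : ι → ℂ) (f : ι → Matrix (Fin 2) (Fin 2) ℂ) :
    tensor (fun i => c i • f i) = (∏ i, c i) • tensor f := by
  ext y z
  simp [tensor_apply, Finset.prod_mul_distrib]

/-- Duality of the partial trace with tensoring by the identity; it carries string expectations from
the chain to a block. -/
theorem trace_reduced_mul_tensor [DecidableEq ι] (A : Finset ι) (ρ : Op ι)
    (f : {i // i ∈ A} → Matrix (Fin 2) (Fin 2) ℂ) :
    (reduced A ρ * tensor f).trace =
      (ρ * tensor fun i => if h : i ∈ A then f ⟨i, h⟩ else 1).trace := by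
  set e := Equiv.piEquivPiSubtypeProd (· ∈ A) fun _ : ι => Fin 2 with he
  have hpos : ∀ a c (i : {i // i ∈ A}), e.symm (a, c) i = a i := by
    intro a c i
    simp [he, Equiv.piEquivPiSubtypeProd]
  have hneg : ∀ a c (i : {i // i ∉ A}), e.symm (a, c) i = c i := by
    intro a c i
    simp only [he, Equiv.piEquivPiSubtypeProd, Equiv.coe_fn_symm_mk]
    rw [dif_neg i.2]
  have ht : ∀ a c b d, tensor (fun i => if h : i ∈ A then f ⟨i, h⟩ else 1) (e.symm (b, d))
      (e.symm (a, c)) = tensor f b a * if d = c then 1 else 0 := by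
    intro a c b d
    rw [tensor_apply, ← Fintype.prod_subtype_mul_prod_subtype (· ∈ A), tensor_apply]
    congr 1
    · refine Finset.prod_congr (by ext; simp) fun i _ => ?_
      rw [dif_pos i.2, hpos, hpos]
    · rw [← Matrix.one_apply, ← tensor_one, tensor_apply]
      refine Finset.prod_congr rfl fun i _ => ?_
      rw [dif_neg i.2, hneg, hneg]
  simp_rw [Matrix.trace, Matrix.diag_apply, Matrix.mul_apply]
  rw [← Equiv.sum_comp e.symm, Fintype.sum_prod_type]
  simp_rw [← Equiv.sum_comp e.symm (fun y => ρ _ y * _), Fintype.sum_prod_type, ht]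
  simp only [mul_ite, mul_one, mul_zero, Finset.sum_ite_eq', Finset.mem_univ, if_true]
  refine Finset.sum_congr rfl fun a _ => ?_
  rw [Finset.sum_comm]
  refine Finset.sum_congr rfl fun b _ => ?_
  rw [reduced, Matrix.of_apply, Finset.sum_mul]

end Tensor

section Klein

variable {κ : Type*} [Fintype κ] [DecidableEq κ]

theorem mul_log_sub_nonneg {l q : ℝ} (hl : 0 ≤ l) (hq : 0 < q) :
    0 ≤ l * Real.log l - l * Real.log q - l + q := by
  rcases hl.eq_or_lt with rfl | hl
  · simpa using hq.le
  · have h1 := Real.log_le_sub_one_of_pos (div_pos hq hl)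
    rw [Real.log_div hq.ne' hl.ne'] at h1
    have h2 := mul_le_mul_of_nonneg_left h1 hl.le
    have h3 : l * (q / l - 1) = q - l := by field_simp
    linarith

theorem entropy_eq_sum {ρ : Matrix κ κ ℂ} (hρ : ρ.IsHermitian) :
    entropy ρ = -∑ i, hρ.eigenvalues i * Real.log (hρ.eigenvalues i) := by
  have h1 : ρ * cfc Real.log ρ = Unitary.conjStarAlgAut ℂ _ hρ.eigenvectorUnitary
      (Matrix.diagonal fun i => ((hρ.eigenvalues i * Real.log (hρ.eigenvalues i) : ℝ) : ℂ)) := by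
    rw [hρ.cfc_eq, Matrix.IsHermitian.cfc]
    conv_lhs => enter [1]; rw [hρ.spectral_theorem]
    rw [← map_mul, Matrix.diagonal_mul_diagonal]
    simp
  rw [entropy, h1, Unitary.conjStarAlgAut_apply, Matrix.trace_mul_comm, ← mul_assoc,
    Unitary.coe_star_mul_self, one_mul, Matrix.trace_diagonal, Complex.re_sum]
  simp only [Complex.ofReal_re]

/-- Klein's inequality for the measurement of a density matrix. -/
theorem entropy_le_crossEntropy {ρ : Matrix κ κ ℂ} (hρ : ρ.PosSemidef) (hρ1 : ρ.trace = 1)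
    {X : Type*} [Fintype X] (E : X → Matrix κ κ ℂ) (hE : ∀ x, (E x).PosSemidef)
    (hsum : ∑ x, E x = 1) (htr : ∀ x, (E x).trace = 1) (q : X → ℝ) (hq : ∀ x, 0 < q x)
    (hq1 : ∑ x, q x = 1) :
    entropy ρ ≤ -∑ x, (ρ * E x).trace.re * Real.log (q x) := by
  set U : Matrix κ κ ℂ := hρ.1.eigenvectorUnitary.1 with hU
  set l := hρ.1.eigenvalues with hl
  have hUU : star U * U = 1 := Unitary.coe_star_mul_self _
  have hUU' : U * star U = 1 := Unitary.coe_mul_star_self _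
  -- The diagonal entries of `E x` in the eigenbasis of `ρ` have all row and column sums equal to
  -- one. Averaging the scalar inequality `mul_log_sub_nonneg` with these weights gives the claim.
  set D : X → κ → ℝ := fun x i => ((star U * E x * U) i i).re with hD
  have hD0 : ∀ x i, 0 ≤ D x i := by
    intro x i
    have h1 : (star U * E x * U).PosSemidef := by
      rw [Matrix.star_eq_conjTranspose]
      exact (hE x).conjTranspose_mul_mul_same U
    have h2 := h1.diag_nonneg (i := i)
    exact (Complex.le_def.1 h2).1
  have hDx : ∀ i, ∑ x, D x i = 1 := by
    intro i
    simp only [hD]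
    rw [← Complex.re_sum, ← Matrix.sum_apply, ← Finset.sum_mul, ← Finset.mul_sum, hsum, mul_one,
      hUU]
    simp
  have hDi : ∀ x, ∑ i, D x i = 1 := by
    intro x
    simp only [hD]
    rw [← Complex.re_sum]
    change (Matrix.trace (star U * E x * U)).re = 1
    rw [Matrix.trace_mul_comm, ← mul_assoc, hUU', one_mul, htr]
    simp
  have hp : ∀ x, (ρ * E x).trace.re = ∑ i, l i * D x i := by
    intro x
    have h1 : ρ = U * Matrix.diagonal (RCLike.ofReal ∘ l) * star U := by
      conv_lhs => rw [hρ.1.spectral_theorem, Unitary.conjStarAlgAut_apply]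
    conv_lhs => rw [h1]
    rw [mul_assoc, mul_assoc, Matrix.trace_mul_comm, mul_assoc, Matrix.trace, Complex.re_sum]
    refine Finset.sum_congr rfl fun i _ => ?_
    rw [Matrix.diag_apply, Matrix.diagonal_mul]
    exact Complex.re_ofReal_mul _ _
  have hl1 : ∑ i, l i = 1 := by
    have h1 := hρ.1.trace_eq_sum_eigenvalues
    rw [hρ1] at h1
    exact Complex.ofReal_injective ((Complex.ofReal_sum _ _).trans h1.symm)
  have key : 0 ≤ ∑ x, ∑ i, D x i * (l i * Real.log (l i) - l i * Real.log (q x) - l i + q x) :=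
    Finset.sum_nonneg fun x _ => Finset.sum_nonneg fun i _ =>
      mul_nonneg (hD0 x i) (mul_log_sub_nonneg (hρ.eigenvalues_nonneg i) (hq x))
  have hexp : ∑ x, ∑ i, D x i * (l i * Real.log (l i) - l i * Real.log (q x) - l i + q x) =
      ∑ i, l i * Real.log (l i) - ∑ x, (ρ * E x).trace.re * Real.log (q x) := by
    simp_rw [mul_add, mul_sub, Finset.sum_add_distrib, Finset.sum_sub_distrib, ← Finset.sum_mul,
      hDi, one_mul, hq1]
    rw [Finset.sum_comm, Finset.sum_comm (f := fun x i => D x i * l i)]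
    simp_rw [← Finset.sum_mul, hDx, one_mul, hl1, hp, Finset.sum_mul]
    have : ∀ x i, D x i * (l i * Real.log (q x)) = l i * D x i * Real.log (q x) :=
      fun x i => by ring
    simp_rw [this]
    ring
  rw [hexp] at key
  rw [entropy_eq_sum hρ.1]
  linarith

end Klein

/-- The eigenvalue sign of a basis label. -/
def sgn : Fin 2 → ℝ := ![1, -1]

theorem sgn_sq (b : Fin 2) : sgn b ^ 2 = 1 := by fin_cases b <;> simp [sgn]

theorem abs_sgn (b : Fin 2) : |sgn b| = 1 := by fin_cases b <;> simp [sgn]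

section Entropy

variable {κ : Type*} [Fintype κ] [DecidableEq κ]

theorem posSemidef_of_sq_eq {m : Type*} [Fintype m] {P : Matrix m m ℂ} (h : Pᴴ = P)
    (h2 : P * P = P) : P.PosSemidef := by
  have := Matrix.posSemidef_conjTranspose_mul_self P
  rwa [h, h2] at this

/-- The projector onto the joint eigenspace of commuting one-qubit involutions. -/
noncomputable def signProj (σ : κ → Matrix (Fin 2) (Fin 2) ℂ) (x : Config κ) : Op κ :=
  tensor fun i => (1 / 2 : ℂ) • (1 + (sgn (x i) : ℂ) • σ i)

/-- The product of the involutions `σ i` over the sites `i ∈ T`. -/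
noncomputable def string (σ : κ → Matrix (Fin 2) (Fin 2) ℂ) (T : Finset κ) : Op κ :=
  tensor fun i => if i ∈ T then σ i else 1

theorem signProj_mul_self {σ : κ → Matrix (Fin 2) (Fin 2) ℂ} (h2 : ∀ i, σ i * σ i = 1)
    (x : Config κ) : signProj σ x * signProj σ x = signProj σ x := by
  rw [signProj, tensor_mul]
  congr 1
  ext1 i
  have h3 : ((sgn (x i) : ℂ)) * sgn (x i) = 1 := by
    rw [← Complex.ofReal_mul, ← pow_two, sgn_sq, Complex.ofReal_one]
  simp only [Matrix.smul_mul, Matrix.mul_smul, add_mul, mul_add, one_mul, mul_one, h2, smul_smul,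
    smul_add]
  match_scalars <;> first | ring1 | linear_combination h3 / 4

theorem signProj_posSemidef {σ : κ → Matrix (Fin 2) (Fin 2) ℂ} (hH : ∀ i, (σ i).IsHermitian)
    (h2 : ∀ i, σ i * σ i = 1) (x : Config κ) : (signProj σ x).PosSemidef := by
  apply posSemidef_of_sq_eq
  · rw [signProj, tensor_conjTranspose]
    congr 1
    ext1 i
    simp [Matrix.conjTranspose_smul, (hH i).eq]
  · exact signProj_mul_self h2 x

theorem trace_signProj {σ : κ → Matrix (Fin 2) (Fin 2) ℂ} (h0 : ∀ i, (σ i).trace = 0)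
    (x : Config κ) : (signProj σ x).trace = 1 := by
  rw [signProj, trace_tensor]
  apply Finset.prod_eq_one
  intro i _
  simp [h0, Matrix.trace_one]

/-- Spectral resolution, site by site: the string on `T` becomes the random sign `∏ i ∈ T, sgn (x
i)` under the joint measurement. -/
theorem sum_sgn_smul_signProj (σ : κ → Matrix (Fin 2) (Fin 2) ℂ) (T : Finset κ) :
    ∑ x, ((∏ i ∈ T, sgn (x i) : ℝ) : ℂ) • signProj σ x = string σ T := by
  have h1 : ∀ x : Config κ, ((∏ i ∈ T, sgn (x i) : ℝ) : ℂ) • signProj σ x =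
      tensor fun i => (fun i b => (if i ∈ T then (sgn b : ℂ) else 1) •
        (1 / 2 : ℂ) • (1 + (sgn b : ℂ) • σ i)) i (x i) := by
    intro x
    simp only
    rw [tensor_smul, signProj]
    congr 1
    rw [Complex.ofReal_prod, Finset.prod_ite_mem, Finset.univ_inter]
  refine (Finset.sum_congr rfl fun x _ => h1 x).trans ((sum_tensor fun i b =>
    (if i ∈ T then (sgn b : ℂ) else 1) • (1 / 2 : ℂ) • (1 + (sgn b : ℂ) • σ i)).trans ?_)
  rw [string]
  congr 1
  ext1 i
  rw [Fin.sum_univ_two]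
  split_ifs
  · simp only [sgn, Matrix.cons_val_zero, Matrix.cons_val_one]
    push_cast
    module
  · simp only [sgn, Matrix.cons_val_zero, Matrix.cons_val_one]
    push_cast
    module

theorem sum_signProj (σ : κ → Matrix (Fin 2) (Fin 2) ℂ) : ∑ x, signProj σ x = 1 := by
  have := sum_sgn_smul_signProj σ ∅
  simpa [string, tensor_one] using this

theorem sum_prod_sgn {T : Finset κ} (hT : T.Nonempty) :
    ∑ x : Config κ, ∏ i ∈ T, sgn (x i) = 0 := by
  have h1 : ∀ x : Config κ, ∏ i ∈ T, sgn (x i) =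
      ∏ i, (fun i b => if i ∈ T then sgn b else 1) i (x i) := by
    intro x
    simp only
    rw [Finset.prod_ite_mem, Finset.univ_inter]
  refine (Finset.sum_congr rfl fun x _ => h1 x).trans
    ((sum_prod_config fun i b => if i ∈ T then sgn b else 1).trans ?_)
  obtain ⟨i, hi⟩ := hT
  apply Finset.prod_eq_zero (Finset.mem_univ i)
  simp [hi, sgn]

theorem trace_mul_re_nonneg {m : Type*} [Fintype m] [DecidableEq m] {A P : Matrix m m ℂ}
    (hA : A.PosSemidef) (h : Pᴴ = P) (h2 : P * P = P) : 0 ≤ (A * P).trace.re := by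
  have h1 := (hA.conjTranspose_mul_mul_same P).trace_nonneg
  rw [h, mul_assoc, Matrix.trace_mul_comm, mul_assoc, h2] at h1
  exact (Complex.le_def.1 h1).1

theorem sub_sq_le_log {y : ℝ} (hy : |y| ≤ 1 / 4) : y - 2 * y ^ 2 ≤ Real.log (1 + y) := by
  have h := abs_le.1 hy
  have hpos : 0 < 1 + y := by linarith
  refine le_trans ?_ (Real.one_sub_inv_le_log_of_pos hpos)
  have h1 : 1 - (1 + y)⁻¹ = y / (1 + y) := by field_simp; ring
  rw [h1, le_div_iff₀ hpos]
  nlinarith [sq_nonneg y, mul_nonneg (sq_nonneg y) (by linarith : 0 ≤ 1 + 2 * y)]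

/-- Expanding the product, disjointness turns every nonconstant term into a sign product over a
nonempty set, which sums to zero. This normalises the trial distribution in `entropy_le_of_strings`.
-/
theorem sum_prod_one_add_sgn {K : Type*} [Fintype K] (T : K → Finset κ)
    (hT : ∀ k, (T k).Nonempty) (hd : Pairwise fun k l => Disjoint (T k) (T l)) (β : K → ℝ) :
    ∑ x : Config κ, ∏ k, (1 + β k * ∏ i ∈ T k, sgn (x i)) = 2 ^ Fintype.card κ := by
  classical
  have h1 : ∀ x : Config κ, ∏ k, (1 + β k * ∏ i ∈ T k, sgn (x i)) =
      ∑ s ∈ (Finset.univ : Finset K).powerset, (∏ k ∈ s, β k) * ∏ i ∈ s.biUnion T, sgn (x i) := by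
    intro x
    rw [Finset.prod_one_add]
    refine Finset.sum_congr rfl fun s _ => ?_
    rw [Finset.prod_mul_distrib, Finset.prod_biUnion fun k _ l _ hkl => hd hkl]
  simp_rw [h1]
  rw [Finset.sum_comm, Finset.sum_eq_single ∅]
  · simp
  · intro s _ hs
    obtain ⟨k, hk⟩ := Finset.nonempty_iff_ne_empty.2 hs
    rw [← Finset.mul_sum, sum_prod_sgn, mul_zero]
    exact Finset.Nonempty.biUnion ⟨k, hk⟩ fun k _ => hT k
  · intro h
    exact absurd (Finset.mem_powerset.2 (Finset.empty_subset _)) h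

/-- Nonzero expectation values of disjoint Pauli strings lower the entropy. -/
theorem entropy_le_of_strings {ρ : Op κ} (hρ : ρ.PosSemidef) (hρ1 : ρ.trace = 1)
    {σ : κ → Matrix (Fin 2) (Fin 2) ℂ} (hH : ∀ i, (σ i).IsHermitian)
    (h2 : ∀ i, σ i * σ i = 1) (h0 : ∀ i, (σ i).trace = 0) {K : Type*} [Fintype K]
    (T : K → Finset κ) (hT : ∀ k, (T k).Nonempty)
    (hd : Pairwise fun k l => Disjoint (T k) (T l)) :
    entropy ρ ≤ Fintype.card κ * Real.log 2 -
      1 / 8 * ∑ k, (ρ * string σ (T k)).trace.re ^ 2 := by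
  set p : Config κ → ℝ := fun x => (ρ * signProj σ x).trace.re with hp
  set χ : K → Config κ → ℝ := fun k x => ∏ i ∈ T k, sgn (x i) with hχ
  set e : K → ℝ := fun k => (ρ * string σ (T k)).trace.re with he
  have hχabs : ∀ k x, |χ k x| = 1 := by
    intro k x
    rw [hχ, Finset.abs_prod]
    exact Finset.prod_eq_one fun i _ => abs_sgn _
  have hp0 : ∀ x, 0 ≤ p x := by
    intro x
    have h1 := signProj_posSemidef hH h2 x
    exact trace_mul_re_nonneg hρ h1.1 (signProj_mul_self h2 x)
  have hp1 : ∑ x, p x = 1 := by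
    simp only [hp]
    rw [← Complex.re_sum, ← Matrix.trace_sum, ← Finset.mul_sum, sum_signProj, mul_one, hρ1,
      Complex.one_re]
  have hpe : ∀ k, ∑ x, p x * χ k x = e k := by
    intro k
    simp only [he]
    rw [← sum_sgn_smul_signProj, Finset.mul_sum, Matrix.trace_sum, Complex.re_sum]
    refine Finset.sum_congr rfl fun x _ => ?_
    rw [Matrix.mul_smul, Matrix.trace_smul, smul_eq_mul, Complex.re_ofReal_mul, mul_comm]
  have he1 : ∀ k, |e k| ≤ 1 := by
    intro k
    rw [← hpe]
    refine (Finset.abs_sum_le_sum_abs _ _).trans ?_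
    simp_rw [abs_mul, hχabs, mul_one, abs_of_nonneg (hp0 _), hp1, le_refl]
  have hy : ∀ k x, |e k / 4 * χ k x| ≤ 1 / 4 := by
    intro k x
    rw [abs_mul, hχabs, mul_one, abs_div, abs_of_pos (by norm_num : (0 : ℝ) < 4)]
    linarith [he1 k]
  have hpos : ∀ k x, 0 < 1 + e k / 4 * χ k x := by
    intro k x
    linarith [(abs_le.1 (hy k x)).1]
  -- The uniform distribution tilted towards the measured signs. The factor 1/4 keeps every tilt in
  -- the range where `log (1 + y) ≥ y - 2 * y ^ 2`; the gain per string is then `e² / 4 - e² / 8`.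
  set q : Config κ → ℝ := fun x => (2 ^ Fintype.card κ)⁻¹ * ∏ k, (1 + e k / 4 * χ k x) with hq
  have hq0 : ∀ x, 0 < q x := fun x =>
    mul_pos (by positivity) (Finset.prod_pos fun k _ => hpos k x)
  have hq1 : ∑ x, q x = 1 := by
    rw [hq, ← Finset.mul_sum, sum_prod_one_add_sgn T hT hd]
    exact inv_mul_cancel₀ (by positivity)
  have hlogq : ∀ x, Real.log (q x) = -(Fintype.card κ * Real.log 2) +
      ∑ k, Real.log (1 + e k / 4 * χ k x) := by
    intro x
    simp only [hq]
    rw [Real.log_mul (by positivity) (Finset.prod_pos fun k _ => hpos k x).ne', Real.log_inv,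
      Real.log_pow, Real.log_prod fun k _ => (hpos k x).ne']
  refine (entropy_le_crossEntropy hρ hρ1 (signProj σ) (signProj_posSemidef hH h2)
    (sum_signProj σ) (trace_signProj h0) q hq0 hq1).trans ?_
  change -∑ x, p x * Real.log (q x) ≤ _ - 1 / 8 * ∑ k, e k ^ 2
  have h3 : ∑ x, p x * Real.log (q x) = -(Fintype.card κ * Real.log 2) +
      ∑ k, ∑ x, p x * Real.log (1 + e k / 4 * χ k x) := by
    simp_rw [hlogq, mul_add, Finset.sum_add_distrib, ← Finset.sum_mul, hp1, one_mul,
      Finset.mul_sum]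
    rw [Finset.sum_comm]
  have h4 : ∀ k, 1 / 8 * e k ^ 2 ≤ ∑ x, p x * Real.log (1 + e k / 4 * χ k x) := by
    intro k
    have h5 : ∑ x, p x * (e k / 4 * χ k x - e k ^ 2 / 8) = 1 / 8 * e k ^ 2 := by
      have h6 : ∀ x, p x * (e k / 4 * χ k x - e k ^ 2 / 8) =
          e k / 4 * (p x * χ k x) - e k ^ 2 / 8 * p x := fun x => by ring
      simp_rw [h6, Finset.sum_sub_distrib, ← Finset.mul_sum, hpe, hp1]
      ring
    rw [← h5]
    refine Finset.sum_le_sum fun x _ => mul_le_mul_of_nonneg_left ?_ (hp0 x)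
    refine le_trans (le_of_eq ?_) (sub_sq_le_log (hy k x))
    have h7 : χ k x ^ 2 = 1 := by rw [← sq_abs, hχabs, one_pow]
    rw [mul_pow, h7]
    ring
  rw [h3, Finset.mul_sum]
  have h8 := Finset.sum_le_sum fun k (_ : k ∈ Finset.univ) => h4 k
  linarith

end Entropy

section Dynamics

variable {κ : Type*} [Fintype κ] [DecidableEq κ]

theorem exp_conjTranspose_evolution {H : Matrix κ κ ℂ} (hH : H.IsHermitian) (t : ℝ) :
    (NormedSpace.exp ((-(Complex.I * t)) • H))ᴴ = NormedSpace.exp ((Complex.I * t) • H) := by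
  rw [← Matrix.exp_conjTranspose, Matrix.conjTranspose_smul, hH.eq]
  congr 2
  simp

theorem exp_mul_exp_evolution (H : Matrix κ κ ℂ) (t : ℝ) :
    NormedSpace.exp ((Complex.I * t) • H) * NormedSpace.exp ((-(Complex.I * t)) • H) = 1 := by
  rw [← Matrix.exp_add_of_commute]
  · simp
  · exact ((Commute.refl H).smul_left _).smul_right _

theorem evolve_ketBra {H : Matrix κ κ ℂ} (hH : H.IsHermitian) (t : ℝ) (Ψ : κ → ℂ) :
    evolve H t (ketBra Ψ) = ketBra (NormedSpace.exp ((-(Complex.I * t)) • H) *ᵥ Ψ) := by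
  rw [evolve, ← exp_conjTranspose_evolution hH, ketBra, ketBra, Matrix.mul_vecMulVec,
    Matrix.vecMulVec_mul, Matrix.star_mulVec]

theorem trace_evolve (H : Matrix κ κ ℂ) (t : ℝ) (ρ : Matrix κ κ ℂ) :
    (evolve H t ρ).trace = ρ.trace := by
  rw [evolve, Matrix.trace_mul_comm, ← mul_assoc, exp_mul_exp_evolution, one_mul]

/-- Conservation law: an observable commuting with `H` commutes with the propagator, which then
cancels by cyclicity of the trace. -/
theorem trace_evolve_mul {H G : Matrix κ κ ℂ} (hG : Commute H G) (t : ℝ) (ρ : Matrix κ κ ℂ) :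
    (evolve H t ρ * G).trace = (ρ * G).trace := by
  have h1 : Commute (NormedSpace.exp ((Complex.I * t) • H)) G := by
    exact (hG.smul_left _).exp_left
  rw [evolve, mul_assoc, h1.eq, ← mul_assoc, Matrix.trace_mul_comm, ← mul_assoc, ← mul_assoc,
    exp_mul_exp_evolution, one_mul]

theorem reduced_ketBra_posSemidef {ι : Type*} [Fintype ι] [DecidableEq ι] (A : Finset ι)
    (Φ : Config ι → ℂ) : (reduced A (ketBra Φ)).PosSemidef := by
  set B : Matrix (Config {i // i ∈ A}) (Config {i // i ∉ A}) ℂ := Matrix.of fun a c =>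
    Φ ((Equiv.piEquivPiSubtypeProd (· ∈ A) fun _ => Fin 2).symm (a, c)) with hB
  have h1 : reduced A (ketBra Φ) = B * Bᴴ := by
    ext a b
    rw [Matrix.mul_apply]
    rfl
  rw [h1]
  exact Matrix.posSemidef_self_mul_conjTranspose B

theorem trace_reduced {ι : Type*} [Fintype ι] [DecidableEq ι] (A : Finset ι)
    (ρ : Op ι) : (reduced A ρ).trace = ρ.trace := by
  have h1 := trace_reduced_mul_tensor A ρ fun _ => 1
  simpa [tensor_one] using h1

end Dynamics

end DensityMatrices

/-! ### Pauli expansion of the Hamiltonian -/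

section PauliDecomposition

/-- The Pauli matrices, where `none` stands for the identity. -/
def pauliOpt (a : Option (Fin 3)) : Matrix (Fin 2) (Fin 2) ℂ := a.elim 1 pauli

theorem pauliOpt_isHermitian (a : Option (Fin 3)) : (pauliOpt a).IsHermitian := by
  cases a with
  | none => exact Matrix.isHermitian_one
  | some α => exact pauli_isHermitian α

/-- Completeness of the Pauli basis; applied to both tensor factors, it inverts the expansion in
`exists_pauli_coeff`. -/
theorem sum_pauliOpt_mul (i j k l : Fin 2) :
    ∑ a, pauliOpt a i j * pauliOpt a k l = if i = l ∧ j = k then 2 else 0 := by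
  rw [Fintype.sum_option, Fin.sum_univ_three]
  fin_cases i <;> fin_cases j <;> fin_cases k <;> fin_cases l <;>
    simp [pauliOpt, pauli] <;> norm_num

/-- Two-qubit Hermitian operators are real combinations of products of Pauli matrices. -/
theorem exists_pauli_coeff {h : Matrix (Fin 2 × Fin 2) (Fin 2 × Fin 2) ℂ} (hh : h.IsHermitian)
    (htr : h.trace = 0) :
    ∃ c : Option (Fin 3) → Option (Fin 3) → ℝ, c none none = 0 ∧
      ∀ u v, h u v = ∑ a, ∑ b, (c a b : ℂ) * (pauliOpt a u.1 v.1 * pauliOpt b u.2 v.2) := by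
  -- The Hilbert–Schmidt coefficient `tr (h (P_a ⊗ P_b)) / 4`.
  set d : Option (Fin 3) → Option (Fin 3) → ℂ := fun a b =>
    1 / 4 * ∑ x, ∑ y, h x y * (pauliOpt a y.1 x.1 * pauliOpt b y.2 x.2) with hd
  have hreal : ∀ a b, ((d a b).re : ℂ) = d a b := by
    intro a b
    rw [← Complex.conj_eq_iff_re]
    simp only [hd, map_mul, map_sum]
    rw [Finset.sum_comm]
    congr 1
    · simp only [map_div₀, map_one, map_ofNat]
    · refine Finset.sum_congr rfl fun x _ => Finset.sum_congr rfl fun y _ => ?_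
      rw [← hh.apply x y, ← (pauliOpt_isHermitian a).apply y.1 x.1,
        ← (pauliOpt_isHermitian b).apply y.2 x.2]
      rfl
  refine ⟨fun a b => (d a b).re, ?_, ?_⟩
  · have h1 : d none none = 1 / 4 * h.trace := by
      simp only [hd, Matrix.trace, Matrix.diag_apply]
      congr 1
      refine Finset.sum_congr rfl fun x _ => ?_
      rw [Finset.sum_eq_single x]
      · simp [pauliOpt]
      · intro y _ hy
        simp only [pauliOpt, Option.elim, Matrix.one_apply]
        by_cases h1 : y.1 = x.1
        · by_cases h2 : y.2 = x.2
          · exact absurd (Prod.ext h1 h2) hy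
          · simp [h2]
        · simp [h1]
      · simp
    simp [h1, htr]
  · intro u v
    simp_rw [hreal]
    have h1 : ∀ a b, d a b * (pauliOpt a u.1 v.1 * pauliOpt b u.2 v.2) =
        1 / 4 * ∑ x, ∑ y, h x y * ((pauliOpt a y.1 x.1 * pauliOpt a u.1 v.1) *
          (pauliOpt b y.2 x.2 * pauliOpt b u.2 v.2)) := by
      intro a b
      simp only [hd, mul_assoc, Finset.sum_mul]
      congr 1
      refine Finset.sum_congr rfl fun x _ => Finset.sum_congr rfl fun y _ => ?_
      ring
    have h2 : ∀ x y, ∑ a, ∑ b, h x y * ((pauliOpt a y.1 x.1 * pauliOpt a u.1 v.1) *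
          (pauliOpt b y.2 x.2 * pauliOpt b u.2 v.2)) =
        if x = u ∧ y = v then 4 * h x y else 0 := by
      intro x y
      simp_rw [← Finset.mul_sum, ← Finset.sum_mul, sum_pauliOpt_mul]
      have h3 : (x = u ∧ y = v) ↔ (y.1 = v.1 ∧ x.1 = u.1) ∧ (y.2 = v.2 ∧ x.2 = u.2) := by
        rw [Prod.ext_iff, Prod.ext_iff]; tauto
      by_cases h4 : y.1 = v.1 ∧ x.1 = u.1 <;> by_cases h5 : y.2 = v.2 ∧ x.2 = u.2 <;>
        simp only [h3, h4, h5, and_self, and_true, and_false, if_true,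
          if_false, mul_zero, zero_mul]
      ring
    simp_rw [h1, ← Finset.mul_sum]
    have h6 : ∑ a, ∑ b, ∑ x, ∑ y, h x y * ((pauliOpt a y.1 x.1 * pauliOpt a u.1 v.1) *
          (pauliOpt b y.2 x.2 * pauliOpt b u.2 v.2)) = ∑ x, ∑ y, ∑ a, ∑ b, h x y *
          ((pauliOpt a y.1 x.1 * pauliOpt a u.1 v.1) *
          (pauliOpt b y.2 x.2 * pauliOpt b u.2 v.2)) :=
      (Finset.sum_congr rfl fun a _ => Finset.sum_comm).trans (Finset.sum_comm.trans
        (Finset.sum_congr rfl fun x _ =>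
          (Finset.sum_congr rfl fun a _ => Finset.sum_comm).trans Finset.sum_comm))
    rw [h6]
    simp_rw [h2, ite_and]
    simp

variable {N : ℕ}

/-- The product of Pauli matrices `a` at site `j` and `b` at site `j + 1`. -/
def bondString (j : Fin N) (a b : Option (Fin 3)) : Op (Fin N) :=
  tensor fun i => if i = j then pauliOpt a else if i = site j 1 then pauliOpt b else 1

theorem site_one_ne (hN : 1 < N) (j : Fin N) : site j 1 ≠ j := by
  intro h
  have h1 : ((j : ℕ) + 1) % N = j := congrArg Fin.val h
  have := j.isLt
  rcases Nat.lt_or_ge ((j : ℕ) + 1) N with h2 | h2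
  · rw [Nat.mod_eq_of_lt h2] at h1; omega
  · rw [show (j : ℕ) + 1 = N by omega, Nat.mod_self] at h1; omega

theorem bondString_apply (hN : 1 < N) (j : Fin N) (a b : Option (Fin 3)) (x y : Config (Fin N)) :
    bondString j a b x y = if ∀ i, i ≠ j → i ≠ site j 1 → x i = y i then
      pauliOpt a (x j) (y j) * pauliOpt b (x (site j 1)) (y (site j 1)) else 0 := by
  have hne := site_one_ne hN j
  rw [bondString, tensor_apply]
  split_ifs with h
  · rw [Finset.prod_eq_mul j (site j 1) hne.symm]
    · simp [hne]
    · intro i _ hi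
      rw [if_neg hi.1, if_neg hi.2, h i hi.1 hi.2, Matrix.one_apply_eq]
    · simp
    · simp
  · push Not at h
    obtain ⟨i, h1, h2, h3⟩ := h
    apply Finset.prod_eq_zero (Finset.mem_univ i)
    simp [h1, h2, h3]

theorem bondOp_eq_sum (hN : 1 < N) (j : Fin N) {h : Matrix (Fin 2 × Fin 2) (Fin 2 × Fin 2) ℂ}
    {c : Option (Fin 3) → Option (Fin 3) → ℝ}
    (hc : ∀ u v, h u v = ∑ a, ∑ b, (c a b : ℂ) * (pauliOpt a u.1 v.1 * pauliOpt b u.2 v.2)) :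
    bondOp j h = ∑ a, ∑ b, (c a b : ℂ) • bondString j a b := by
  ext x y
  simp_rw [Matrix.sum_apply, Matrix.smul_apply, bondString_apply hN, bondOp, Matrix.of_apply]
  split_ifs
  · exact hc _ _
  · simp

/-- The nearest-neighbour operator with the given Pauli coefficients. -/
noncomputable def pauliSum (m : Fin N → Fin 3 → Option (Fin 3) → ℝ) : Op (Fin N) :=
  ∑ j, ∑ α, ∑ β, (m j α β : ℂ) • bondString j (some α) β

theorem site_injective (k : ℕ) : Function.Injective fun j : Fin N => site j k := by
  intro i j h
  have h1 : ((i : ℕ) + k) % N = (j + k) % N := congrArg Fin.val h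
  have h2 : (i : ℕ) ≡ j [MOD N] := Nat.ModEq.add_right_cancel' k h1
  exact Fin.ext (Nat.ModEq.eq_of_lt_of_lt h2 i.isLt j.isLt)

/-- Translation by `k` sites. -/
noncomputable def shift (k : ℕ) : Equiv.Perm (Fin N) :=
  Equiv.ofBijective _ (Finite.injective_iff_bijective.1 (site_injective k))

theorem shift_apply (k : ℕ) (j : Fin N) : shift k j = site j k := rfl

theorem bondString_none_some (hN : 1 < N) (j : Fin N) (β : Fin 3) :
    bondString j none (some β) = bondString (site j 1) (some β) none := by
  have hne := site_one_ne hN j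
  rw [bondString, bondString]
  congr 1
  ext1 i
  by_cases h1 : i = j
  · subst h1
    simp [hne.symm, pauliOpt]
  · by_cases h2 : i = site j 1
    · subst h2
      simp [hne, pauliOpt]
    · simp [h1, h2, pauliOpt]

theorem exists_hamiltonian_eq_pauliSum (hN : 1 < N)
    {h : Fin N → Matrix (Fin 2 × Fin 2) (Fin 2 × Fin 2) ℂ} (hh : ∀ j, (h j).IsHermitian)
    (htr : ∀ j, (h j).trace = 0) : ∃ m, hamiltonian h = pauliSum m := by
  choose c hc0 hc using fun j => exists_pauli_coeff (hh j) (htr j)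
  -- A field on the second site of a bond is booked as a field on the first site of the next bond,
  -- so every string begins with a genuine Pauli matrix.
  refine ⟨fun j α β => c j (some α) β + β.elim (c ((shift 1).symm j) none (some α)) fun _ => 0, ?_⟩
  have h1 : ∀ j, bondOp j (h j) = ∑ α, ∑ β, (c j (some α) β : ℂ) • bondString j (some α) β +
      ∑ α, (c j none (some α) : ℂ) • bondString (shift 1 j) (some α) none := by
    intro j
    rw [bondOp_eq_sum hN j (hc j), Fintype.sum_option, add_comm]
    congr 1
    rw [Fintype.sum_option, hc0]
    simp [bondString_none_some hN, shift_apply]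
  rw [hamiltonian, Finset.sum_congr rfl fun j _ => h1 j, Finset.sum_add_distrib, pauliSum]
  rw [← Equiv.sum_comp (shift 1).symm fun j => ∑ α, (c j none (some α) : ℂ) •
    bondString (shift 1 j) (some α) none, ← Finset.sum_add_distrib]
  refine Finset.sum_congr rfl fun j _ => ?_
  rw [← Finset.sum_add_distrib]
  refine Finset.sum_congr rfl fun α _ => ?_
  simp only [Fintype.sum_option, Option.elim, Equiv.apply_symm_apply, Complex.ofReal_add, add_smul,
    Complex.ofReal_zero, zero_smul, add_zero]
  abel

theorem exists_conserved_pauliSum (hN : 1 < N)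
    {h : Fin N → Matrix (Fin 2 × Fin 2) (Fin 2 × Fin 2) ℂ} (hh : ∀ j, (h j).IsHermitian)
    (htr : ∀ j, (h j).trace = 0) :
    ∃ m, 0 < ∑ j, ∑ α, ∑ β, m j α β ^ 2 ∧ Commute (hamiltonian h) (pauliSum m) := by
  obtain ⟨m, hm⟩ := exists_hamiltonian_eq_pauliSum hN hh htr
  have h0 : 0 ≤ ∑ j, ∑ α, ∑ β, m j α β ^ 2 := by positivity
  rcases h0.eq_or_lt with h1 | h1
  -- If all coefficients vanish then `H = 0` commutes with everything, and any nonzero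
  -- nearest-neighbour operator can play the role of the energy.
  · refine ⟨fun _ _ _ => 1, ?_, ?_⟩
    · have : Nonempty (Fin N) := ⟨⟨0, by omega⟩⟩
      positivity
    · have h2 : ∀ j α β, m j α β = 0 := by
        intro j α β
        have h3 := (Finset.sum_eq_zero_iff_of_nonneg fun j _ => by positivity).1 h1.symm j
          (Finset.mem_univ _)
        have h4 := (Finset.sum_eq_zero_iff_of_nonneg fun j _ => by positivity).1 h3 α
          (Finset.mem_univ _)
        have h5 := (Finset.sum_eq_zero_iff_of_nonneg fun j _ => by positivity).1 h4 β
          (Finset.mem_univ _)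
        exact pow_eq_zero_iff two_ne_zero |>.1 h5
      have h3 : hamiltonian h = 0 := by
        rw [hm, pauliSum]
        simp [h2]
      rw [h3]
      exact Commute.zero_left _
  · exact ⟨m, h1, hm ▸ Commute.refl _⟩

theorem hamiltonian_isHermitian {h : Fin N → Matrix (Fin 2 × Fin 2) (Fin 2 × Fin 2) ℂ}
    (hh : ∀ j, (h j).IsHermitian) : (hamiltonian h).IsHermitian := by
  rw [Matrix.IsHermitian, hamiltonian, Matrix.conjTranspose_sum]
  refine Finset.sum_congr rfl fun j _ => ?_
  ext x y
  simp only [Matrix.conjTranspose_apply, bondOp, Matrix.of_apply, apply_ite star, star_zero,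
    (hh j).apply, eq_comm (a := y _)]

end PauliDecomposition

/-! ### Expectation values in product states -/

section ProductState

variable {N : ℕ}

theorem ketBra_productState (ψ : Fin N → QubitState) :
    ketBra (productState ψ) = tensor fun i =>
      ketBra (ψ i : EuclideanSpace ℂ (Fin 2)).ofLp := by
  ext x y
  simp [ketBra, Matrix.vecMulVec_apply, productState, tensor_apply, Finset.prod_mul_distrib]

theorem trace_ketBra_mul {σ : Matrix (Fin 2) (Fin 2) ℂ} (hσ : σ.IsHermitian) (ψ : QubitState) :
    (ketBra (ψ : EuclideanSpace ℂ (Fin 2)).ofLp * σ).trace = expect σ ψ := by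
  set v := (ψ : EuclideanSpace ℂ (Fin 2)).ofLp with hv
  have h1 : (ketBra v * σ).trace = star v ⬝ᵥ (σ *ᵥ v) := by
    rw [ketBra, Matrix.vecMulVec_mul, Matrix.trace_vecMulVec, Matrix.dotProduct_mulVec,
      dotProduct_comm]
  rw [h1, expect, ← hv, eq_comm, ← Complex.conj_eq_iff_re]
  change star (star v ⬝ᵥ (σ *ᵥ v)) = _
  rw [← Matrix.star_dotProduct, Matrix.star_mulVec, hσ.eq, Matrix.dotProduct_mulVec]

theorem expect_one (ψ : QubitState) : expect 1 ψ = 1 := by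
  have h := normSq_add_normSq ψ
  rw [← Complex.normSq_eq_norm_sq, ← Complex.normSq_eq_norm_sq, Complex.normSq_apply,
    Complex.normSq_apply] at h
  rw [expect, Matrix.one_mulVec, dotProduct, Fin.sum_univ_two]
  simp
  linarith

theorem trace_productState_mul_tensor (ψ : Fin N → QubitState)
    {f : Fin N → Matrix (Fin 2) (Fin 2) ℂ} (hf : ∀ i, (f i).IsHermitian) :
    (ketBra (productState ψ) * tensor f).trace = ((∏ i, expect (f i) (ψ i) : ℝ) : ℂ) := by
  rw [ketBra_productState, tensor_mul, trace_tensor, Complex.ofReal_prod]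
  exact Finset.prod_congr rfl fun i _ => trace_ketBra_mul (hf i) _

theorem trace_ketBra_productState (ψ : Fin N → QubitState) :
    (ketBra (productState ψ)).trace = 1 := by
  have h := trace_productState_mul_tensor ψ (f := fun _ => 1) fun _ => Matrix.isHermitian_one
  simpa [tensor_one, expect_one] using h

theorem trace_productState_mul_bondString (hN : 1 < N) (ψ : Fin N → QubitState) (j : Fin N)
    (α : Fin 3) (β : Option (Fin 3)) :
    (ketBra (productState ψ) * bondString j (some α) β).trace =
      ((bloch α (ψ j) * blochOpt β (ψ (site j 1)) : ℝ) : ℂ) := by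
  have hne := site_one_ne hN j
  rw [bondString, trace_productState_mul_tensor]
  · congr 1
    rw [Finset.prod_eq_mul j (site j 1) hne.symm]
    · simp only [if_true, hne, if_false]
      congr 1
      cases β with
      | none => exact expect_one _
      | some β => rfl
    · intro i _ hi
      simp [hi.1, hi.2, expect_one]
    · simp
    · simp
  · intro i
    split_ifs
    · exact pauliOpt_isHermitian _
    · exact pauliOpt_isHermitian _
    · exact Matrix.isHermitian_one

end ProductState

/-! ### Entropy of the blocks -/

section Block

variable {N : ℕ}

/-- The distance from `j` to `i` in the positive direction of the periodic chain. -/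
def offset (j i : Fin N) : ℕ := if (j : ℕ) ≤ i then i - j else i + N - j

theorem eq_site_iff {j i : Fin N} {r : ℕ} (hr : r < N) : i = site j r ↔ offset j i = r := by
  have h1 := i.isLt
  have h2 := j.isLt
  rw [Fin.ext_iff, offset, site]
  simp only
  rcases Nat.lt_or_ge ((j : ℕ) + r) N with h | h
  · rw [Nat.mod_eq_of_lt h]
    split_ifs <;> omega
  · rw [Nat.mod_eq_sub_mod h, Nat.mod_eq_of_lt (by omega)]
    split_ifs <;> omega

theorem site_site (j : Fin N) (k l : ℕ) : site (site j k) l = site j (k + l) := by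
  simp [site, Nat.add_assoc]

theorem site_mem_block (j : Fin N) {n r : ℕ} (hr : r < n) : site j r ∈ block j n :=
  Finset.mem_image_of_mem _ (Finset.mem_range.2 hr)

theorem card_block_le (j : Fin N) (n : ℕ) : (block j n).card ≤ n :=
  Finset.card_image_le.trans (by simp)

/-- The expectation values of the Pauli strings on disjoint bonds inside a block bound its
entropy. -/
theorem entropy_reduced_block_le (Φ : Config (Fin N) → ℂ) (hΦ : (ketBra Φ).trace = 1) {n : ℕ}
    (hn : n ≤ N) (j : Fin N) (α : Fin 3) (β : Option (Fin 3)) :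
    entropy (reduced (block j n) (ketBra Φ)) ≤ n * Real.log 2 -
      1 / 8 * ∑ k : Fin (n / 2),
        (ketBra Φ * bondString (site j (2 * k)) (some α) β).trace.re ^ 2 := by
  set A := block j n with hA
  -- For `β = none` the default Pauli matrix at odd offsets is irrelevant, because the sets `T k`
  -- then contain only even offsets.
  set γ : Fin 3 := β.getD 0 with hγ
  set σ : {i // i ∈ A} → Matrix (Fin 2) (Fin 2) ℂ := fun i =>
    if offset j i % 2 = 0 then pauli α else pauli γ with hσ
  set T : Fin (n / 2) → Finset {i // i ∈ A} := fun k => Finset.univ.filter fun i =>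
    offset j i = 2 * k ∨ (offset j i = 2 * k + 1 ∧ β.isSome) with hT
  have hk : ∀ k : Fin (n / 2), 2 * (k : ℕ) + 1 < n := fun k => by have := k.isLt; omega
  have hmain := entropy_le_of_strings (reduced_ketBra_posSemidef A Φ)
    ((trace_reduced A _).trans hΦ) (σ := σ)
    (fun i => by simp only [hσ]; split_ifs <;> exact pauli_isHermitian _)
    (fun i => by simp only [hσ]; split_ifs <;> exact pauli_mul_self _)
    (fun i => by simp only [hσ]; split_ifs <;> exact pauli_trace _) T
    (fun k => ⟨⟨site j (2 * k), site_mem_block j (by have := hk k; omega)⟩, by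
      simp only [hT, Finset.mem_filter, Finset.mem_univ, true_and]
      exact Or.inl ((eq_site_iff (by have := hk k; omega)).1 rfl)⟩)
    (fun k l hkl => by
      refine Finset.disjoint_left.2 fun i hi hi' => ?_
      simp only [hT, Finset.mem_filter, Finset.mem_univ, true_and] at hi hi'
      exact hkl (Fin.ext (by omega)))
  have hstring : ∀ k, (reduced A (ketBra Φ) * string σ (T k)).trace =
      (ketBra Φ * bondString (site j (2 * k)) (some α) β).trace := by
    intro k
    have hk' := hk k
    rw [string, trace_reduced_mul_tensor, bondString]
    congr 3
    ext1 i
    have h3 : i = site j (2 * k) ↔ offset j i = 2 * k := eq_site_iff (by omega)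
    have h4 : i = site j (2 * k + 1) ↔ offset j i = 2 * k + 1 := eq_site_iff (by omega)
    simp only [site_site, h3, h4]
    have hmem : ∀ r < n, offset j i = r → i ∈ A := by
      intro r hr h
      rw [(eq_site_iff (by omega)).2 h]
      exact site_mem_block j hr
    simp only [hT, hσ, Finset.mem_filter, Finset.mem_univ, true_and]
    by_cases h1 : offset j i = 2 * k
    · rw [dif_pos (hmem _ (by omega) h1), if_pos (Or.inl h1), if_pos (by omega), if_pos h1]
      rfl
    · by_cases h2 : offset j i = 2 * k + 1
      · rw [dif_pos (hmem _ (by omega) h2), if_neg h1, if_pos h2]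
        cases β with
        | none => simp [h1, pauliOpt]
        | some b =>
          rw [if_pos (Or.inr ⟨h2, rfl⟩), if_neg (by omega : ¬ offset j i % 2 = 0)]
          rfl
      · rw [if_neg h1, if_neg h2]
        simp [h1, h2]
  simp_rw [hstring] at hmain
  refine hmain.trans (sub_le_sub_right ?_ _)
  have hlog : 0 ≤ Real.log 2 := Real.log_nonneg one_le_two
  refine mul_le_mul_of_nonneg_right ?_ hlog
  rw [Fintype.card_coe]
  exact_mod_cast card_block_le j n

/-- The average entropy of the blocks is bounded by the expectation values of all Pauli strings on
single bonds. -/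
theorem sum_entropy_reduced_block_le (Φ : Config (Fin N) → ℂ) (hΦ : (ketBra Φ).trace = 1) {n : ℕ}
    (hn : n ≤ N) :
    12 * ∑ j, entropy (reduced (block j n) (ketBra Φ)) ≤ 12 * (N * (n * Real.log 2)) -
      1 / 8 * ((n / 2 : ℕ) *
        ∑ j, ∑ α, ∑ β, (ketBra Φ * bondString j (some α) β).trace.re ^ 2) := by
  set e : Fin N → Fin 3 → Option (Fin 3) → ℝ := fun j α β =>
    (ketBra Φ * bondString j (some α) β).trace.re with he
  have h1 : ∀ α β, ∑ j, entropy (reduced (block j n) (ketBra Φ)) ≤ N * (n * Real.log 2) -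
      1 / 8 * ((n / 2 : ℕ) * ∑ j, e j α β ^ 2) := by
    intro α β
    have h2 := Finset.sum_le_sum fun j (_ : j ∈ Finset.univ) =>
      entropy_reduced_block_le Φ hΦ hn j α β
    -- As the block runs around the cycle, its `k`-th bond visits every bond once.
    have h3 : ∀ k : Fin (n / 2), ∑ j, e (site j (2 * k)) α β ^ 2 = ∑ j, e j α β ^ 2 := fun k =>
      Equiv.sum_comp (shift (2 * (k : ℕ))) fun j => e j α β ^ 2
    have h6 : ∑ j, ∑ k : Fin (n / 2), e (site j (2 * k)) α β ^ 2 =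
        (n / 2 : ℕ) * ∑ j, e j α β ^ 2 := by
      rw [Finset.sum_comm, Finset.sum_congr rfl fun k _ => h3 k]
      simp
    rw [Finset.sum_sub_distrib, Finset.sum_const, ← Finset.mul_sum, h6, Finset.card_univ,
      Fintype.card_fin, nsmul_eq_mul] at h2
    exact h2
  have h4 := Finset.sum_le_sum fun α (_ : α ∈ Finset.univ) =>
    Finset.sum_le_sum fun β (_ : β ∈ Finset.univ) => h1 α β
  simp only [Finset.sum_sub_distrib, ← Finset.mul_sum, Finset.sum_const, Finset.card_univ,
    Fintype.card_option, Fintype.card_fin, nsmul_eq_mul] at h4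
  have h5 : ∑ j, ∑ α, ∑ β, e j α β ^ 2 = ∑ α, ∑ β, ∑ j, e j α β ^ 2 := by
    rw [Finset.sum_comm]
    exact Finset.sum_congr rfl fun α _ => Finset.sum_comm
  rw [h5]
  push_cast at h4
  linarith

end Block

/-! ### Three-colouring of the cycle -/

section Coloring

variable {N : ℕ}

/-- A proper colouring of the cycle. -/
def cycleColor (j : Fin N) : Fin 3 :=
  -- The third colour at the last site makes the colouring proper for odd `N` as well.
  if (j : ℕ) + 1 = N then 2 else if (j : ℕ) % 2 = 0 then 0 else 1

theorem cycleColor_shift_ne (hN : 1 < N) (j : Fin N) : cycleColor (shift 1 j) ≠ cycleColor j := by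
  have h1 := j.isLt
  have h2 : (shift 1 j : ℕ) = (j + 1) % N := rfl
  rw [cycleColor, cycleColor, h2]
  rcases Nat.lt_or_ge ((j : ℕ) + 1) N with h | h
  · rw [Nat.mod_eq_of_lt h]
    split_ifs <;> omega
  · rw [show (j : ℕ) + 1 = N by omega, Nat.mod_self]
    split_ifs <;> omega

theorem shift_ne_shift_symm (hN : 2 < N) (j : Fin N) : shift 1 j ≠ (shift 1).symm j := by
  intro h
  have h1 : shift 1 (shift 1 j) = j := by rw [h, Equiv.apply_symm_apply]
  rw [shift_apply, shift_apply, site_site, eq_comm, eq_site_iff (by omega), offset] at h1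
  simp at h1

end Coloring

/-! ### Assembly -/

/-- If the energy of the initial state is not small compared with the coefficients of a conserved
nearest-neighbour operator, then the average entropy is bounded at all times. -/
theorem averageEntropy_le {N n : ℕ} (hn : 1 < n) (hN : 2 * n ≤ N) {H : Op (Fin N)}
    (hH : H.IsHermitian) {m : Fin N → Fin 3 → Option (Fin 3) → ℝ}
    (hm : 0 < ∑ j, ∑ α, ∑ β, m j α β ^ 2) (hcomm : Commute H (pauliSum m)) {ε : ℝ} (hε : 0 ≤ ε)
    (ψ : Fin N → QubitState)
    (hE : ε * ∑ j, ∑ α, ∑ β, m j α β ^ 2 ≤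
      (∑ j, ∑ α, ∑ β, m j α β * (bloch α (ψ j) * blochOpt β (ψ (shift 1 j)))) ^ 2) (t : ℝ) :
    averageEntropy H (productState ψ) t n ≤ n * Real.log 2 - ε / 288 * (n / N) := by
  set W := ∑ j, ∑ α, ∑ β, m j α β ^ 2 with hW
  set Φ := NormedSpace.exp ((-(Complex.I * t)) • H) *ᵥ productState ψ with hΦ
  have hev : evolve H t (ketBra (productState ψ)) = ketBra Φ := evolve_ketBra hH t _
  have htr : (ketBra Φ).trace = 1 := by
    rw [← hev, trace_evolve, trace_ketBra_productState]
  set e : Fin N → Fin 3 → Option (Fin 3) → ℝ := fun j α β =>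
    (ketBra Φ * bondString j (some α) β).trace.re with he
  have hlin : ∀ ρ : Op (Fin N), (ρ * pauliSum m).trace.re =
      ∑ j, ∑ α, ∑ β, m j α β * (ρ * bondString j (some α) β).trace.re := by
    intro ρ
    simp only [pauliSum, Finset.mul_sum, Matrix.trace_sum, Complex.re_sum, Matrix.mul_smul,
      Matrix.trace_smul, smul_eq_mul, Complex.re_ofReal_mul]
  have hcons : ∑ j, ∑ α, ∑ β, m j α β * (bloch α (ψ j) * blochOpt β (ψ (shift 1 j))) =
      ∑ j, ∑ α, ∑ β, m j α β * e j α β := by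
    have h1 := congrArg Complex.re (trace_evolve_mul hcomm t (ketBra (productState ψ)))
    rw [hev, hlin, hlin] at h1
    simp only [he]
    rw [h1]
    simp only [trace_productState_mul_bondString (by omega : 1 < N), Complex.ofReal_re, shift_apply]
  have hCS : (∑ j, ∑ α, ∑ β, m j α β * e j α β) ^ 2 ≤ W * ∑ j, ∑ α, ∑ β, e j α β ^ 2 := by
    have h1 := Finset.sum_mul_sq_le_sq_mul_sq
      (Finset.univ : Finset (Fin N × Fin 3 × Option (Fin 3)))
      (fun k => m k.1 k.2.1 k.2.2) (fun k => e k.1 k.2.1 k.2.2)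
    simpa only [Fintype.sum_prod_type] using h1
  have hsum : ε ≤ ∑ j, ∑ α, ∑ β, e j α β ^ 2 := by
    rw [hcons] at hE
    have h1 := hE.trans hCS
    rw [mul_comm] at h1
    exact le_of_mul_le_mul_left h1 hm
  have hS := sum_entropy_reduced_block_le Φ htr (n := n) (by omega)
  have hNpos : (0 : ℝ) < N := by exact_mod_cast (by omega : 0 < N)
  -- The floor costs at most this for `n ≥ 2`. With the 12 types of strings and the 1/8 of the
  -- entropy bound, `12 * 8 * 3 = 288`.
  have hn3 : (n : ℝ) / 3 ≤ (n / 2 : ℕ) := by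
    rw [div_le_iff₀ (by norm_num)]
    exact_mod_cast (by omega : n ≤ n / 2 * 3)
  have hprod : (n : ℝ) / 3 * ε ≤ (n / 2 : ℕ) * ∑ j, ∑ α, ∑ β, e j α β ^ 2 := by gcongr
  rw [averageEntropy, div_le_iff₀ hNpos]
  simp only [entanglementEntropy, hev]
  have h9 : (n * Real.log 2 - ε / 288 * (n / N)) * N =
      N * (n * Real.log 2) - ε / 288 * n := by field_simp
  rw [h9]
  simp only [he] at hprod
  linarith

end QubitChain

theorem mainTheorem1 (a b δ : ℝ) (ha : 0 < a) (hδ : 0 < δ) :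
    ∃ c : ℝ, 0 < c ∧
      ∀ (N n : ℕ) (h : Fin N → Matrix (Fin 2 × Fin 2) (Fin 2 × Fin 2) ℂ),
        1 < n → 2 * n ≤ N →
        (∀ j, (h j).IsHermitian) →
        (∀ j, (h j).trace = 0) →
        (∀ j, a ≤ QubitChain.opNorm (h j) ∧ QubitChain.opNorm (h j) ≤ b) →
        1 - δ ≤ (QubitChain.haarProduct N).real
          {ψ | ∀ t : ℝ,
            QubitChain.averageEntropy (QubitChain.hamiltonian h) (QubitChain.productState ψ) t n ≤
              n * Real.log 2 - c * (n / N)} := by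
  obtain ⟨ε, hε, hball⟩ := QubitChain.exists_smallBall_chain δ hδ
  refine ⟨ε / 288, by positivity, fun N n h hn hN hh htr _ => ?_⟩
  obtain ⟨m, hm, hcomm⟩ := QubitChain.exists_conserved_pauliSum (by omega) hh htr
  -- Here `N ≥ 4`, so the two neighbours of a site are distinct, as the two-site estimate requires.
  have h1 := hball (QubitChain.shift 1) QubitChain.cycleColor
    (QubitChain.cycleColor_shift_ne (by omega)) (QubitChain.shift_ne_shift_symm (by omega)) m
  set B := {ψ : Fin N → QubitChain.QubitState |
    (∑ j, ∑ α, ∑ β, m j α β * (QubitChain.bloch α (ψ j) *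
      QubitChain.blochOpt β (ψ (QubitChain.shift 1 j)))) ^ 2 <
        ε * ∑ j, ∑ α, ∑ β, m j α β ^ 2} with hB
  set G := {ψ : Fin N → QubitChain.QubitState | ∀ t : ℝ,
    QubitChain.averageEntropy (QubitChain.hamiltonian h) (QubitChain.productState ψ) t n ≤
      n * Real.log 2 - ε / 288 * (n / N)} with hG
  -- The exceptional event `B` concerns the initial energy only, so a single event serves all times
  -- at once.
  have h2 : Set.univ ⊆ B ∪ G := by
    intro ψ _
    by_cases hψ : ψ ∈ B
    · exact Or.inl hψ
    · exact Or.inr (QubitChain.averageEntropy_le hn hN (QubitChain.hamiltonian_isHermitian hh) hm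
        hcomm hε.le ψ (not_lt.1 hψ))
  have h3 := (MeasureTheory.measureReal_mono h2).trans
    (MeasureTheory.measureReal_union_le (μ := QubitChain.haarProduct N) B G)
  have h4 : (QubitChain.haarProduct N).real B ≤ δ := h1
  rw [MeasureTheory.probReal_univ] at h3
  linarith
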